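/- Let $p$ be a prime, let $R$ be a commutative ring of characteristic $p$ (for instance a field), let $V$ be a free $R$-module (for instance a vector space), and let $m\ge 1$ be an integer divisible by $p$. Write $S_j(V)$ and $\bigwedge^i V$ for the symmetric and exterior powers, with $S_j(V)=0$ for $j<0$. Let $$\kappa:\bigwedge^{i+1}V\otimes S_j(V)\xrightarrow{\Delta\otimes 1}\bigwedge^{i}V\otimes V\otimes S_j(V)\xrightarrow{1\otimes \mathrm{mult}}\bigwedge^{i}V\otimes S_{j+1}(V)$$ be the Koszul map and $$\varphi:\bigwedge^i V\otimes S_j(V)\xrightarrow{1\otimes\Delta}\bigwedge^i V\otimes V\otimes S_{j-1}(V)\xrightarrow{\mathrm{mult}\otimes 1}\bigwedge^{i+1}V\otimes S_{j-1}(V),$$ where $\Delta$ denotes comultiplication in the exterior, respectively symmetric, algebra. For an integer $a$ and $b\ge 0$ let $$S_{(a,1^b)}(V)=\operatorname{Coker}\Big(\kappa:\bigwedge^{b+2}V\otimes S_{a-2}(V)\to\bigwedge^{b+1}V\otimes S_{a-1}(V)\Big)$$ be the Schur module of the hook partition $(a,1^b)$, with its natural $\operatorname{GL}(V)$-action; it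 is $0$ for $a\le 0$, and $S_{(m)}(V)\cong S_m(V)$ (through multiplication), $S_{(1,1^{m-1})}(V)\cong\bigwedge^m V$. For an $R$-module $W$ let $F^pW=R\otimes_{\mathrm{Frob}}W$ be its base change along the Frobenius endomorphism $r\mapsto r^p$ of $R$; a linear action of $\operatorname{GL}(V)$ on $W$ induces the linear action $g(r\otimes w)=r\otimes gw$ on $F^pW$. The map $\varphi$ induces $\operatorname{GL}(V)$-equivariant maps $S_{(m-i,1^i)}(V)\to S_{(m-i-1,1^{i+1})}(V)$ for all $i\ge 0$. **Theorem.** The sequence $$N_m(V):\quad 0\to S_m(V)\to S_{(m-1,1)}(V)\to\cdots\to S_{(m-i,1^i)}(V)\to\cdots\to\bigwedge^m V\to 0,$$ with $S_{(m-i,1^i)}(V)$ in cohomological degree $i$ and with the differentials induced by $\varphi$, is a complex, and for every $i\ge 0$ there is a $\operatorname{GL}(V)$-equivariant isomorphism of $R$-modules $$H^i(N_m(V))\;\cong\;F^pS_{(m/p-i,1^i)}(V).$$ -/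

import Mathlib

open scoped TensorProduct

noncomputable section

namespace HookComplex

universe u w

variable (R : Type u) [CommRing R] (V : Type w) [AddCommGroup V] [Module R V]

/-! ### The bialgebra structure maps -/

/-- The projection of the symmetric algebra of `V` onto its degree one component `V`. -/
def symProjOne : SymmetricAlgebra R V →ₗ[R] V :=
  letI : Module Rᵐᵒᵖ V := Module.compHom _ ((RingHom.id R).fromOpposite mul_comm)
  haveI : IsCentralScalar R V := ⟨fun _ _ => rfl⟩
  TrivSqZeroExt.sndHom R V ∘ₗ
    (SymmetricAlgebra.lift (TrivSqZeroExt.inrHom R V)).toLinearMap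

/-- The component `S(V) → V ⊗ S(V)` of the comultiplication of the symmetric algebra. -/
def symComul : SymmetricAlgebra R V →ₗ[R] V ⊗[R] SymmetricAlgebra R V :=
  (symProjOne R V).rTensor (SymmetricAlgebra R V) ∘ₗ Coalgebra.comul

/-- The component `⋀ V → ⋀ V ⊗ V` of the comultiplication of the exterior algebra:
`v₀ ∧ ⋯ ∧ vₙ ↦ ∑ₖ (-1)ⁿ⁻ᵏ (v₀ ∧ ⋯ v̂ₖ ⋯ ∧ vₙ) ⊗ vₖ` (see `extComul_apply`). -/
def extComul : ExteriorAlgebra R V →ₗ[R] ExteriorAlgebra R V ⊗[R] V :=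
  ExteriorAlgebra.liftAlternating fun
    | 0 => 0
    | n + 1 => (-1 : R) ^ n • AlternatingMap.alternatizeUncurryFin
        { toFun := fun v =>
            ((TensorProduct.mk R (ExteriorAlgebra R V) V).flip v).compAlternatingMap
              (ExteriorAlgebra.ιMulti R n)
          map_add' := fun v w => by ext; simp
          map_smul' := fun r v => by ext; simp }

theorem extComul_apply (n : ℕ) (v : Fin (n + 1) → V) :
    extComul R V (ExteriorAlgebra.ιMulti R (n + 1) v) =
      (-1 : R) ^ n • ∑ k : Fin (n + 1), (-1 : ℤ) ^ (k : ℕ) •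
        (ExteriorAlgebra.ιMulti R n (k.removeNth v) ⊗ₜ[R] v k) := by
  rw [extComul, ExteriorAlgebra.liftAlternating_apply_ιMulti]
  simp [AlternatingMap.alternatizeUncurryFin_apply]

/-! ### The two differentials on `⋀ V ⊗ S(V)` -/

/-- The map `φ`: the composition of `1 ⊗ Δ : ⋀ V ⊗ S(V) → ⋀ V ⊗ V ⊗ S(V)` with
`m ⊗ 1 : ⋀ V ⊗ V ⊗ S(V) → ⋀ V ⊗ S(V)`. -/
def phiT : ExteriorAlgebra R V ⊗[R] SymmetricAlgebra R V →ₗ[R]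
    ExteriorAlgebra R V ⊗[R] SymmetricAlgebra R V :=
  (LinearMap.mul' R (ExteriorAlgebra R V) ∘ₗ
      (ExteriorAlgebra.ι R).lTensor (ExteriorAlgebra R V)).rTensor (SymmetricAlgebra R V) ∘ₗ
    (TensorProduct.assoc R (ExteriorAlgebra R V) V (SymmetricAlgebra R V)).symm.toLinearMap ∘ₗ
    (symComul R V).lTensor (ExteriorAlgebra R V)

/-- The Koszul map `κ`: the composition of `Δ ⊗ 1 : ⋀ V ⊗ S(V) → ⋀ V ⊗ V ⊗ S(V)` with
`1 ⊗ m : ⋀ V ⊗ V ⊗ S(V) → ⋀ V ⊗ S(V)`. -/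
def kappaT : ExteriorAlgebra R V ⊗[R] SymmetricAlgebra R V →ₗ[R]
    ExteriorAlgebra R V ⊗[R] SymmetricAlgebra R V :=
  (LinearMap.mul' R (SymmetricAlgebra R V) ∘ₗ
      (SymmetricAlgebra.ι R V).rTensor (SymmetricAlgebra R V)).lTensor (ExteriorAlgebra R V) ∘ₗ
    (TensorProduct.assoc R (ExteriorAlgebra R V) V (SymmetricAlgebra R V)).toLinearMap ∘ₗ
    (extComul R V).rTensor (SymmetricAlgebra R V)

section rules

variable {V}

/-- `x ⊗ s ↦ (x ∧ v) ⊗ s` -/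
def mulExtT (v : V) : ExteriorAlgebra R V ⊗[R] SymmetricAlgebra R V →ₗ[R]
    ExteriorAlgebra R V ⊗[R] SymmetricAlgebra R V :=
  (LinearMap.mulRight R (ExteriorAlgebra.ι R v)).rTensor (SymmetricAlgebra R V)

/-- `x ⊗ s ↦ x ⊗ (v s)` -/
def mulSymT (v : V) : ExteriorAlgebra R V ⊗[R] SymmetricAlgebra R V →ₗ[R]
    ExteriorAlgebra R V ⊗[R] SymmetricAlgebra R V :=
  (LinearMap.mulLeft R (SymmetricAlgebra.ι R V v)).lTensor (ExteriorAlgebra R V)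

variable {R}

@[simp]
theorem mulExtT_tmul (v : V) (x : ExteriorAlgebra R V) (s : SymmetricAlgebra R V) :
    mulExtT R v (x ⊗ₜ[R] s) = (x * ExteriorAlgebra.ι R v) ⊗ₜ[R] s := rfl

@[simp]
theorem mulSymT_tmul (v : V) (x : ExteriorAlgebra R V) (s : SymmetricAlgebra R V) :
    mulSymT R v (x ⊗ₜ[R] s) = x ⊗ₜ[R] (SymmetricAlgebra.ι R V v * s) := rfl

theorem symProjOne_one : symProjOne R V 1 = 0 := by
  let : Module Rᵐᵒᵖ V := Module.compHom _ ((RingHom.id R).fromOpposite mul_comm)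
  have : IsCentralScalar R V := ⟨fun _ _ => rfl⟩
  simp [symProjOne, map_one]

theorem symProjOne_mul (v : V) (s : SymmetricAlgebra R V) :
    symProjOne R V (SymmetricAlgebra.ι R V v * s) =
      SymmetricAlgebra.algebraMapInv s • v := by
  let : Module Rᵐᵒᵖ V := Module.compHom _ ((RingHom.id R).fromOpposite mul_comm)
  have : IsCentralScalar R V := ⟨fun _ _ => rfl⟩
  have h : (TrivSqZeroExt.fstHom R R V).comp
      (SymmetricAlgebra.lift (TrivSqZeroExt.inrHom R V)) = SymmetricAlgebra.algebraMapInv := by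
    ext x
    simp [SymmetricAlgebra.algebraMapInv]
  have h' := congr($h s)
  simp only [AlgHom.comp_apply, TrivSqZeroExt.fstHom_apply] at h'
  simp [symProjOne, ← h']

theorem symComul_one : symComul R V 1 = 0 := by
  simp [symComul, Algebra.TensorProduct.one_def, symProjOne_one]

theorem symComul_mul (v : V) (s : SymmetricAlgebra R V) :
    symComul R V (SymmetricAlgebra.ι R V v * s) =
      v ⊗ₜ s + (LinearMap.mulLeft R (SymmetricAlgebra.ι R V v)).lTensor V (symComul R V s) := by
  have h1 : ∀ t : SymmetricAlgebra R V ⊗[R] SymmetricAlgebra R V,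
      (symProjOne R V).rTensor _ ((SymmetricAlgebra.ι R V v ⊗ₜ[R] 1 +
          1 ⊗ₜ[R] SymmetricAlgebra.ι R V v) * t) =
        v ⊗ₜ[R] (TensorProduct.lid R _
          ((SymmetricAlgebra.algebraMapInv (R := R) (M := V)).toLinearMap.rTensor _ t)) +
        (LinearMap.mulLeft R (SymmetricAlgebra.ι R V v)).lTensor V
          ((symProjOne R V).rTensor _ t) := by
    intro t
    induction t with
    | zero => simp
    | add x y hx hy => simp only [mul_add, map_add, hx, hy, TensorProduct.tmul_add]; abel
    | tmul x y =>
      simp [add_mul, symProjOne_mul, TensorProduct.smul_tmul]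
  have h2 : TensorProduct.lid R _ ((SymmetricAlgebra.algebraMapInv (R := R) (M := V)).toLinearMap.rTensor
      (SymmetricAlgebra R V) (Coalgebra.comul (R := R) s)) = s := by
    have := Coalgebra.rTensor_counit_comul (R := R) s
    have h3 : (SymmetricAlgebra.algebraMapInv (R := R) (M := V)).toLinearMap = Coalgebra.counit := by
      rw [← SymmetricAlgebra.counitAlgHom_eq]; rfl
    rw [h3, this]; simp
  simp only [symComul, LinearMap.comp_apply, Bialgebra.comul_mul, SymmetricAlgebra.comul_ι, h1, h2]

theorem extComul_one : extComul R V 1 = 0 := by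
  simp [extComul]

theorem extComul_mul (x : ExteriorAlgebra R V) (v : V) :
    extComul R V (x * ExteriorAlgebra.ι R v) =
      x ⊗ₜ v - (LinearMap.mulRight R (ExteriorAlgebra.ι R v)).rTensor V (extComul R V x) := by
  have key : ∀ (n : ℕ) (a : Fin n → V),
      extComul R V (ExteriorAlgebra.ιMulti R n a * ExteriorAlgebra.ι R v) =
        ExteriorAlgebra.ιMulti R n a ⊗ₜ v - (LinearMap.mulRight R (ExteriorAlgebra.ι R v)).rTensor V
          (extComul R V (ExteriorAlgebra.ιMulti R n a)) := by
    intro n a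
    have hs : ∀ (n : ℕ) (a : Fin n → V),
        ExteriorAlgebra.ιMulti R n a * ExteriorAlgebra.ι R v =
          ExteriorAlgebra.ιMulti R (n + 1) (Fin.snoc a v : Fin (n + 1) → V) := by
      intro n a
      simp only [ExteriorAlgebra.ιMulti_apply, List.ofFn_succ', List.concat_eq_append]
      simp
    rw [hs, extComul_apply, Fin.sum_univ_castSucc]
    cases n with
    | zero =>
      have : (Fin.snoc a v : Fin 1 → V) 0 = v := by
        simpa using Fin.snoc_last (α := fun _ : Fin 1 => V) v a
      simp [extComul_one, this]
    | succ n =>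
      have hrem : ∀ k : Fin (n + 1),
          (Fin.castSucc k).removeNth (Fin.snoc a v : Fin (n + 1 + 1) → V) =
            (Fin.snoc (k.removeNth a) v : Fin (n + 1) → V) := by
        intro k
        ext j
        refine Fin.lastCases ?_ (fun j => ?_) j
        · simp [Fin.removeNth]
        · simp [Fin.removeNth]
      have hlast : (Fin.last (n + 1)).removeNth (Fin.snoc a v : Fin (n + 1 + 1) → V) = a := by
        ext j; simp [Fin.removeNth]
      rw [extComul_apply]
      simp only [hrem, hlast, ← hs, Fin.snoc_castSucc, Fin.snoc_last, map_smul, map_sum,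
        map_zsmul, LinearMap.rTensor_tmul, LinearMap.mulRight_apply, Fin.val_castSucc,
        Fin.val_last, smul_add, pow_succ]
      have e : ((-1 : R) ^ n * -1) • ((-1 : ℤ) ^ n * -1) •
          (ExteriorAlgebra.ιMulti R (n + 1) a ⊗ₜ[R] v) =
          (ExteriorAlgebra.ιMulti R (n + 1) a ⊗ₜ[R] v) := by
        rcases Nat.even_or_odd n with h | h <;> simp [h.neg_one_pow]
      rw [e]
      simp only [mul_neg, mul_one, neg_smul]
      abel
  have hx : x ∈ Submodule.span R (Set.range fun a : Σ n, (Fin n → V) =>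
      ExteriorAlgebra.ιMulti R a.1 a.2) := by
    rw [ExteriorAlgebra.ιMulti_span]; trivial
  induction hx using Submodule.span_induction with
  | mem x h => obtain ⟨⟨n, a⟩, rfl⟩ := h; exact key n a
  | zero => simp
  | add x y _ _ hx hy => simp only [add_mul, map_add, hx, hy, TensorProduct.add_tmul]; abel
  | smul r x _ hx =>
    simp only [smul_mul_assoc, map_smul, hx, smul_sub, TensorProduct.smul_tmul']

theorem phiT_one : phiT R V (1 ⊗ₜ 1) = 0 := by
  simp [phiT, symComul_one]

theorem kappaT_one : kappaT R V (1 ⊗ₜ 1) = 0 := by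
  simp [kappaT, extComul_one]

theorem mulExtT_mulSymT (v w : V) (y : ExteriorAlgebra R V ⊗[R] SymmetricAlgebra R V) :
    mulExtT R v (mulSymT R w y) = mulSymT R w (mulExtT R v y) := by
  induction y using TensorProduct.induction_on with
  | zero => simp
  | add x y hx hy => simp only [map_add, hx, hy]
  | tmul x s => simp

theorem mulExtT_mulExtT (v w : V) (y : ExteriorAlgebra R V ⊗[R] SymmetricAlgebra R V) :
    mulExtT R v (mulExtT R w y) = - mulExtT R w (mulExtT R v y) := by
  induction y using TensorProduct.induction_on with
  | zero => simp
  | add x y hx hy => simp only [map_add, hx, hy]; abel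
  | tmul x s =>
    have h := ExteriorAlgebra.ι_add_mul_swap (R := R) w v
    rw [← eq_neg_iff_add_eq_zero] at h
    simp only [mulExtT_tmul, mul_assoc, h]
    simp [TensorProduct.neg_tmul]

theorem phiT_mulSymT (v : V) (y : ExteriorAlgebra R V ⊗[R] SymmetricAlgebra R V) :
    phiT R V (mulSymT R v y) = mulExtT R v y + mulSymT R v (phiT R V y) := by
  induction y using TensorProduct.induction_on with
  | zero => simp
  | add x y hx hy => simp only [map_add, hx, hy]; abel
  | tmul x s =>
    simp only [mulSymT_tmul, phiT, LinearMap.comp_apply, LinearMap.lTensor_tmul, symComul_mul,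
      TensorProduct.tmul_add, map_add]
    congr 1
    generalize symComul R V s = t
    induction t with
    | zero => simp
    | add a b ha hb => simp only [map_add, TensorProduct.tmul_add, ha, hb]
    | tmul a b => simp

theorem phiT_mulExtT (v : V) (y : ExteriorAlgebra R V ⊗[R] SymmetricAlgebra R V) :
    phiT R V (mulExtT R v y) = - mulExtT R v (phiT R V y) := by
  induction y using TensorProduct.induction_on with
  | zero => simp
  | add x y hx hy => simp only [map_add, hx, hy]; abel
  | tmul x s =>
    simp only [mulExtT_tmul, phiT, LinearMap.comp_apply, LinearMap.lTensor_tmul]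
    generalize symComul R V s = t
    induction t with
    | zero => simp
    | add a b ha hb => simp only [map_add, TensorProduct.tmul_add, ha, hb]; abel
    | tmul a b =>
      have := mulExtT_mulExtT (R := R) a v (x ⊗ₜ b)
      simpa using this

theorem kappaT_mulExtT (v : V) (y : ExteriorAlgebra R V ⊗[R] SymmetricAlgebra R V) :
    kappaT R V (mulExtT R v y) = mulSymT R v y - mulExtT R v (kappaT R V y) := by
  induction y using TensorProduct.induction_on with
  | zero => simp
  | add x y hx hy => simp only [map_add, hx, hy]; abel
  | tmul x s =>
    simp only [mulExtT_tmul, kappaT, LinearMap.comp_apply, LinearMap.rTensor_tmul, extComul_mul,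
      TensorProduct.sub_tmul, map_sub]
    congr 1
    generalize extComul R V x = t
    induction t with
    | zero => simp
    | add a b ha hb => simp only [map_add, TensorProduct.add_tmul, ha, hb]
    | tmul a b => simp

theorem kappaT_mulSymT (v : V) (y : ExteriorAlgebra R V ⊗[R] SymmetricAlgebra R V) :
    kappaT R V (mulSymT R v y) = mulSymT R v (kappaT R V y) := by
  induction y using TensorProduct.induction_on with
  | zero => simp
  | add x y hx hy => simp only [map_add, hx, hy]
  | tmul x s =>
    simp only [mulSymT_tmul, kappaT, LinearMap.comp_apply, LinearMap.rTensor_tmul]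
    generalize extComul R V x = t
    induction t with
    | zero => simp
    | add a b ha hb => simp only [map_add, TensorProduct.add_tmul, ha, hb]
    | tmul a b => simp [mul_left_comm]

end rules

/-- The algebra `⋀ V ⊗ S(V)`, of which the modules `⋀ⁱ V ⊗ Sⱼ(V)` are the bigraded pieces.
(It is a `def`, with its module structure registered below, so that instance search does not look
into the tensor product.) -/
def Ambient : Type (max u w) := ExteriorAlgebra R V ⊗[R] SymmetricAlgebra R V

instance : AddCommGroup (Ambient R V) :=
  inferInstanceAs (AddCommGroup (ExteriorAlgebra R V ⊗[R] SymmetricAlgebra R V))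

instance : Module R (Ambient R V) :=
  inferInstanceAs (Module R (ExteriorAlgebra R V ⊗[R] SymmetricAlgebra R V))

/-- The pure tensors `x ⊗ s` in `⋀ V ⊗ S(V)`. -/
def tmul : ExteriorAlgebra R V →ₗ[R] SymmetricAlgebra R V →ₗ[R] Ambient R V :=
  TensorProduct.mk R (ExteriorAlgebra R V) (SymmetricAlgebra R V)

/-- The map `φ : ⋀ V ⊗ S(V) → ⋀ V ⊗ S(V)`. -/
def phi : Ambient R V →ₗ[R] Ambient R V := phiT R V

/-- The Koszul map `κ : ⋀ V ⊗ S(V) → ⋀ V ⊗ S(V)`. -/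
def kappa : Ambient R V →ₗ[R] Ambient R V := kappaT R V

/-- The symmetric power `Sⱼ(V)` as a submodule of the symmetric algebra; it is zero for `j < 0`. -/
def symPow : ℤ → Submodule R (SymmetricAlgebra R V)
  | Int.ofNat n => LinearMap.range (SymmetricAlgebra.ι R V) ^ n
  | Int.negSucc _ => ⊥

/-- `⋀ⁱ V ⊗ Sⱼ(V)` as a submodule of `⋀ V ⊗ S(V)`. Both `⋀ⁱ V` and `Sⱼ(V)` are direct summands of
the respective algebras, so this is the tensor product of these two modules. -/
def piece (i : ℕ) (j : ℤ) : Submodule R (Ambient R V) :=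
  Submodule.map₂ (tmul R V) (⋀[R]^i V) (symPow R V j)

section pieces

variable {V}

/-- `x ⊗ s ↦ (x ∧ v) ⊗ s` -/
def mulExt (v : V) : Ambient R V →ₗ[R] Ambient R V := mulExtT R v

/-- `x ⊗ s ↦ x ⊗ (v s)` -/
def mulSym (v : V) : Ambient R V →ₗ[R] Ambient R V := mulSymT R v

variable {R}

theorem mulExt_tmul (v : V) (x : ExteriorAlgebra R V) (s : SymmetricAlgebra R V) :
    mulExt R v (tmul R V x s) = tmul R V (x * ExteriorAlgebra.ι R v) s := rfl

theorem mulSym_tmul (v : V) (x : ExteriorAlgebra R V) (s : SymmetricAlgebra R V) :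
    mulSym R v (tmul R V x s) = tmul R V x (SymmetricAlgebra.ι R V v * s) := rfl

theorem phi_one : phi R V (tmul R V 1 1) = 0 := phiT_one

theorem kappa_one : kappa R V (tmul R V 1 1) = 0 := kappaT_one

theorem phi_mulSym (v : V) (y : Ambient R V) :
    phi R V (mulSym R v y) = mulExt R v y + mulSym R v (phi R V y) := phiT_mulSymT v y

theorem phi_mulExt (v : V) (y : Ambient R V) :
    phi R V (mulExt R v y) = - mulExt R v (phi R V y) := phiT_mulExtT v y

theorem kappa_mulExt (v : V) (y : Ambient R V) :
    kappa R V (mulExt R v y) = mulSym R v y - mulExt R v (kappa R V y) := kappaT_mulExtT v y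

theorem kappa_mulSym (v : V) (y : Ambient R V) :
    kappa R V (mulSym R v y) = mulSym R v (kappa R V y) := kappaT_mulSymT v y

/-- To prove a property of the elements of `⋀ⁱ V ⊗ Sⱼ(V)` it suffices to treat products of
vectors, adding one vector at a time. -/
theorem piece_induction {P : ℕ → ℤ → Submodule R (Ambient R V)}
    (one : tmul R V 1 1 ∈ P 0 0)
    (ext : ∀ i, ∀ v : V, ∀ y ∈ P i 0, mulExt R v y ∈ P (i + 1) 0)
    (sym : ∀ i, ∀ n : ℕ, ∀ v : V, ∀ y ∈ P i n, mulSym R v y ∈ P i (n + 1 : ℕ))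
    (i : ℕ) (j : ℤ) : piece R V i j ≤ P i j := by
  rcases j with n | n
  · refine Submodule.map₂_le.2 fun x hx s hs => ?_
    change s ∈ LinearMap.range (SymmetricAlgebra.ι R V) ^ n at hs
    change tmul R V x s ∈ P i (n : ℤ)
    induction hs using Submodule.pow_induction_on_left' with
    | algebraMap r =>
      rw [Algebra.algebraMap_eq_smul_one, map_smul]
      refine Submodule.smul_mem _ _ ?_
      change x ∈ LinearMap.range (ExteriorAlgebra.ι R) ^ i at hx
      induction hx using Submodule.pow_induction_on_right' with
      | algebraMap r =>
        rw [Algebra.algebraMap_eq_smul_one, map_smul, LinearMap.smul_apply]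
        exact Submodule.smul_mem _ _ one
      | add x y i hx hy h h' => rw [map_add, LinearMap.add_apply]; exact add_mem h h'
      | mul_mem i x hx h m hm =>
        obtain ⟨v, rfl⟩ := hm
        exact ext i v _ h
    | add s t n hs ht h h' => rw [map_add]; exact add_mem h h'
    | mem_mul m hm n s hs h =>
      obtain ⟨v, rfl⟩ := hm
      exact sym i n v _ h
  · refine Submodule.map₂_le.2 fun x hx s hs => ?_
    have : s = 0 := hs
    simp [this]

theorem mulExt_mem (v : V) {i : ℕ} {j : ℤ} {y : Ambient R V} (hy : y ∈ piece R V i j) :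
    mulExt R v y ∈ piece R V (i + 1) j := by
  suffices piece R V i j ≤ (piece R V (i + 1) j).comap (mulExt R v) from this hy
  refine Submodule.map₂_le.2 fun x hx s hs => ?_
  refine Submodule.apply_mem_map₂ _ ?_ hs
  change _ ∈ LinearMap.range (ExteriorAlgebra.ι R) ^ (i + 1)
  rw [pow_succ]
  exact Submodule.mul_mem_mul hx ⟨v, rfl⟩

theorem mulSym_mem (v : V) {i : ℕ} {j : ℤ} {y : Ambient R V} (hy : y ∈ piece R V i j) :
    mulSym R v y ∈ piece R V i (j + 1) := by
  suffices piece R V i j ≤ (piece R V i (j + 1)).comap (mulSym R v) from this hy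
  refine Submodule.map₂_le.2 fun x hx s hs => ?_
  rcases j with n | n
  · refine Submodule.apply_mem_map₂ _ hx ?_
    change _ ∈ LinearMap.range (SymmetricAlgebra.ι R V) ^ (n + 1)
    rw [pow_succ']
    exact Submodule.mul_mem_mul ⟨v, rfl⟩ hs
  · have : s = 0 := hs
    simp [this]

theorem one_mem : tmul R V 1 1 ∈ piece R V 0 0 := by
  refine Submodule.apply_mem_map₂ _ ?_ ?_
  · change _ ∈ LinearMap.range (ExteriorAlgebra.ι R) ^ 0
    simp
  · change _ ∈ LinearMap.range (SymmetricAlgebra.ι R V) ^ 0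
    simp

theorem phi_mem {i : ℕ} {j : ℤ} {y : Ambient R V} (hy : y ∈ piece R V i j) :
    phi R V y ∈ piece R V (i + 1) (j - 1) := by
  refine (piece_induction
    (P := fun i j => piece R V i j ⊓ (piece R V (i + 1) (j - 1)).comap (phi R V))
    ?_ ?_ ?_ i j hy).2
  · refine Submodule.mem_inf.2 ⟨one_mem, ?_⟩
    rw [Submodule.mem_comap, phi_one]
    exact zero_mem _
  · intro i v y h
    obtain ⟨hy, hy'⟩ := Submodule.mem_inf.1 h
    refine Submodule.mem_inf.2 ⟨mulExt_mem v hy, ?_⟩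
    rw [Submodule.mem_comap] at hy' ⊢
    rw [phi_mulExt]
    exact neg_mem (mulExt_mem v hy')
  · intro i n v y h
    obtain ⟨hy, hy'⟩ := Submodule.mem_inf.1 h
    rw [Submodule.mem_comap] at hy'
    have h1 := mulSym_mem v hy
    have h2 := mulSym_mem v hy'
    have e1 : ((n + 1 : ℕ) : ℤ) = n + 1 := by push_cast; ring
    have e2 : (n : ℤ) + 1 - 1 = n := by ring
    rw [sub_add_cancel] at h2
    rw [e1]
    refine Submodule.mem_inf.2 ⟨h1, ?_⟩
    rw [Submodule.mem_comap, phi_mulSym, e2]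
    exact add_mem (mulExt_mem v hy) h2

/-- On `⋀ⁱ V ⊗ Sⱼ(V)` one has `φ κ + κ φ = i + j`. -/
theorem phi_kappa_add {i : ℕ} {j : ℤ} {y : Ambient R V} (hy : y ∈ piece R V i j) :
    phi R V (kappa R V y) + kappa R V (phi R V y) = ((i : ℤ) + j) • y := by
  refine piece_induction (P := fun i j => LinearMap.eqLocus
    (phi R V ∘ₗ kappa R V + kappa R V ∘ₗ phi R V) (((i : ℤ) + j) • LinearMap.id)) ?_ ?_ ?_ i j hy
  · simp [phi_one, kappa_one]
  · intro i v y hy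
    simp only [LinearMap.mem_eqLocus, LinearMap.add_apply, LinearMap.comp_apply,
      LinearMap.smul_apply, LinearMap.id_apply, kappa_mulExt, phi_mulExt, map_sub, map_neg,
      phi_mulSym] at hy ⊢
    rw [show ((i + 1 : ℕ) : ℤ) + 0 = (i + 0) + 1 by push_cast; ring, add_smul, one_smul,
      ← map_zsmul, ← hy, map_add]
    abel
  · intro i n v y hy
    simp only [LinearMap.mem_eqLocus, LinearMap.add_apply, LinearMap.comp_apply,
      LinearMap.smul_apply, LinearMap.id_apply, kappa_mulExt, phi_mulSym, map_add,
      kappa_mulSym] at hy ⊢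
    rw [show (i : ℤ) + (n + 1 : ℕ) = (i + n) + 1 by push_cast; ring, add_smul, one_smul,
      ← map_zsmul, ← hy, map_add]
    abel

end pieces

/-! ### The action of the general linear group -/

/-- The diagonal action of `GL(V)` on `⋀ V ⊗ S(V)`: an element `g` acts by the algebra
endomorphisms of `⋀ V` and of `S(V)` that extend `g : V → V`. -/
def ambientRepT : Representation R (LinearMap.GeneralLinearGroup R V)
    (ExteriorAlgebra R V ⊗[R] SymmetricAlgebra R V) where
  toFun g := TensorProduct.map (ExteriorAlgebra.map (g : V →ₗ[R] V)).toLinearMap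
    (SymmetricAlgebra.lift (SymmetricAlgebra.ι R V ∘ₗ (g : V →ₗ[R] V))).toLinearMap
  map_one' := by
    have h : (SymmetricAlgebra.lift
        (SymmetricAlgebra.ι R V ∘ₗ ((1 : LinearMap.GeneralLinearGroup R V) : V →ₗ[R] V))) =
        AlgHom.id R _ := by
      ext; simp
    have h' : ExteriorAlgebra.map ((1 : LinearMap.GeneralLinearGroup R V) : V →ₗ[R] V) =
        AlgHom.id R _ := by
      ext; simp
    rw [h, h']
    exact TensorProduct.map_id
  map_mul' g h := by
    have e : (SymmetricAlgebra.lift (SymmetricAlgebra.ι R V ∘ₗ ((g * h :) : V →ₗ[R] V))) =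
        (SymmetricAlgebra.lift (SymmetricAlgebra.ι R V ∘ₗ (g : V →ₗ[R] V))).comp
        (SymmetricAlgebra.lift (SymmetricAlgebra.ι R V ∘ₗ (h : V →ₗ[R] V))) := by
      ext; simp
    have e' : ExteriorAlgebra.map ((g * h :) : V →ₗ[R] V) =
        (ExteriorAlgebra.map (g : V →ₗ[R] V)).comp (ExteriorAlgebra.map (h : V →ₗ[R] V)) := by
      ext; simp
    refine TensorProduct.ext' fun x s => ?_
    have h1 := congr($e s)
    have h2 := congr($e' x)
    simp only [AlgHom.comp_apply] at h1 h2
    rw [Module.End.mul_apply]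
    simp only [TensorProduct.map_tmul, AlgHom.toLinearMap_apply]
    rw [h1, h2]

/-- The diagonal action of `GL(V)` on `⋀ V ⊗ S(V)`. -/
def ambientRep : Representation R (LinearMap.GeneralLinearGroup R V) (Ambient R V) :=
  ambientRepT R V

section equivariance

variable {R V}

theorem ambientRep_tmul (g : LinearMap.GeneralLinearGroup R V) (x : ExteriorAlgebra R V)
    (s : SymmetricAlgebra R V) :
    ambientRep R V g (tmul R V x s) = tmul R V (ExteriorAlgebra.map (g : V →ₗ[R] V) x)
      (SymmetricAlgebra.lift (SymmetricAlgebra.ι R V ∘ₗ (g : V →ₗ[R] V)) s) := rfl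

theorem ambientRep_mulExt (g : LinearMap.GeneralLinearGroup R V) (v : V) (y : Ambient R V) :
    ambientRep R V g (mulExt R v y) =
      mulExt R ((g : V →ₗ[R] V) v) (ambientRep R V g y) := by
  change ExteriorAlgebra R V ⊗[R] SymmetricAlgebra R V at y
  change ambientRepT R V g (mulExtT R v y) =
    mulExtT R ((g : V →ₗ[R] V) v) (ambientRepT R V g y)
  induction y using TensorProduct.induction_on with
  | zero => simp only [map_zero]
  | add x y hx hy => simp only [map_add, hx, hy]
  | tmul x s => simp [ambientRepT]

theorem ambientRep_mulSym (g : LinearMap.GeneralLinearGroup R V) (v : V) (y : Ambient R V) :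
    ambientRep R V g (mulSym R v y) =
      mulSym R ((g : V →ₗ[R] V) v) (ambientRep R V g y) := by
  change ExteriorAlgebra R V ⊗[R] SymmetricAlgebra R V at y
  change ambientRepT R V g (mulSymT R v y) =
    mulSymT R ((g : V →ₗ[R] V) v) (ambientRepT R V g y)
  induction y using TensorProduct.induction_on with
  | zero => simp only [map_zero]
  | add x y hx hy => simp only [map_add, hx, hy]
  | tmul x s => simp [ambientRepT]

theorem ambientRep_one_tmul (g : LinearMap.GeneralLinearGroup R V) :
    ambientRep R V g (tmul R V 1 1) = tmul R V 1 1 := by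
  simp [ambientRep_tmul]

theorem ambientRep_mem (g : LinearMap.GeneralLinearGroup R V) {i : ℕ} {j : ℤ}
    {y : Ambient R V} (hy : y ∈ piece R V i j) : ambientRep R V g y ∈ piece R V i j := by
  refine piece_induction
    (P := fun i j => (piece R V i j).comap (ambientRep R V g)) ?_ ?_ ?_ i j hy
  · simpa [ambientRep_one_tmul] using one_mem
  · intro i v y hy
    simpa [ambientRep_mulExt] using mulExt_mem _ hy
  · intro i n v y hy
    simpa [ambientRep_mulSym] using mulSym_mem _ hy

theorem ambientRep_phi (g : LinearMap.GeneralLinearGroup R V) {i : ℕ} {j : ℤ}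
    {y : Ambient R V} (hy : y ∈ piece R V i j) :
    ambientRep R V g (phi R V y) = phi R V (ambientRep R V g y) := by
  refine piece_induction (P := fun _ _ => LinearMap.eqLocus
    (ambientRep R V g ∘ₗ phi R V) (phi R V ∘ₗ ambientRep R V g)) ?_ ?_ ?_ i j hy
  · simp [phi_one, ambientRep_one_tmul]
  · intro i v y hy
    simp only [LinearMap.mem_eqLocus, LinearMap.comp_apply] at hy ⊢
    simp only [phi_mulExt, ambientRep_mulExt, map_neg, hy]
  · intro i n v y hy
    simp only [LinearMap.mem_eqLocus, LinearMap.comp_apply] at hy ⊢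
    simp only [phi_mulSym, ambientRep_mulExt, ambientRep_mulSym, map_add, hy]

theorem ambientRep_kappa (g : LinearMap.GeneralLinearGroup R V) {i : ℕ} {j : ℤ}
    {y : Ambient R V} (hy : y ∈ piece R V i j) :
    ambientRep R V g (kappa R V y) = kappa R V (ambientRep R V g y) := by
  refine piece_induction (P := fun _ _ => LinearMap.eqLocus
    (ambientRep R V g ∘ₗ kappa R V) (kappa R V ∘ₗ ambientRep R V g)) ?_ ?_ ?_ i j hy
  · simp [kappa_one, ambientRep_one_tmul]
  · intro i v y hy
    simp only [LinearMap.mem_eqLocus, LinearMap.comp_apply] at hy ⊢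
    simp only [kappa_mulExt, ambientRep_mulExt, ambientRep_mulSym, map_sub, hy]
  · intro i n v y hy
    simp only [LinearMap.mem_eqLocus, LinearMap.comp_apply] at hy ⊢
    simp only [kappa_mulSym, ambientRep_mulSym, hy]

end equivariance

/-! ### Hook Schur modules -/

/-- The image of `κ : ⋀ᵇ⁺² V ⊗ Sₐ₋₂(V) → ⋀ᵇ⁺¹ V ⊗ Sₐ₋₁(V)`, as a submodule of the target. -/
def hookRel (a : ℤ) (b : ℕ) : Submodule R (piece R V (b + 1) (a - 1)) :=
  ((piece R V (b + 2) (a - 2)).map (kappa R V)).submoduleOf (piece R V (b + 1) (a - 1))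

/-- The Schur module `S_{(a,1ᵇ)}(V)` of a hook partition: the cokernel of
`κ : ⋀ᵇ⁺² V ⊗ Sₐ₋₂(V) → ⋀ᵇ⁺¹ V ⊗ Sₐ₋₁(V)`. It is zero for `a ≤ 0`. -/
abbrev HookSchur (a : ℤ) (b : ℕ) : Type (max u w) :=
  piece R V (b + 1) (a - 1) ⧸ hookRel R V a b

/-- The action of `GL(V)` on the Schur module `S_{(a,1ᵇ)}(V)`. -/
def hookRep (a : ℤ) (b : ℕ) :
    Representation R (LinearMap.GeneralLinearGroup R V) (HookSchur R V a b) :=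
  ((ambientRep R V).subrepresentation (piece R V (b + 1) (a - 1))
    fun g _ hy => ambientRep_mem g hy).quotient (hookRel R V a b) (by
      rintro g ⟨y, hy⟩ ⟨z, hz, hzy⟩
      exact ⟨ambientRep R V g z, ambientRep_mem g hz, by
        rw [← ambientRep_kappa g hz, hzy]; rfl⟩)

/-! ### The complex `N_m(V)` and its cohomology -/

/-- The `i`-th term `S_{(m-i,1ⁱ)}(V)` of the complex `N_m(V)`; it is zero for `i ≥ m`. -/
abbrev Term (m i : ℕ) : Type (max u w) := HookSchur R V ((m : ℤ) - i) i

/-- The differential `S_{(m-i,1ⁱ)}(V) → S_{(m-i-1,1ⁱ⁺¹)}(V)` of `N_m(V)`, induced by the map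
`φ : ⋀ⁱ⁺¹ V ⊗ Sₘ₋ᵢ₋₁(V) → ⋀ⁱ⁺² V ⊗ Sₘ₋ᵢ₋₂(V)`. This descends to the Schur modules when `m = 0`
in `R`. -/
def diff (m : ℕ) (hm : (m : R) = 0) (i : ℕ) : Term R V m i →ₗ[R] Term R V m (i + 1) :=
  Submodule.mapQ _ _
    ((phi R V).restrict (p := piece R V (i + 1) ((m : ℤ) - i - 1))
      (q := piece R V (i + 1 + 1) ((m : ℤ) - (i + 1 : ℕ) - 1)) fun y hy => by
        have h := phi_mem hy
        rwa [show (m : ℤ) - i - 1 - 1 = (m : ℤ) - (i + 1 : ℕ) - 1 by push_cast; ring] at h) (by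
    rintro ⟨y, hy⟩ ⟨z, hz, hzy⟩
    refine ⟨-phi R V z, neg_mem ?_, ?_⟩
    · have h := phi_mem hz
      rwa [show (m : ℤ) - i - 2 - 1 = (m : ℤ) - (i + 1 : ℕ) - 2 by push_cast; ring] at h
    · have h := phi_kappa_add hz
      rw [show ((i + 2 : ℕ) : ℤ) + ((m : ℤ) - i - 2) = (m : ℤ) by push_cast; ring,
        natCast_zsmul, ← Nat.cast_smul_eq_nsmul R, hm, zero_smul, hzy] at h
      rw [map_neg]
      exact (eq_neg_of_add_eq_zero_left h).symm)

/-- The differential of `N_m(V)` is `GL(V)`-equivariant. -/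
theorem diff_hookRep (m : ℕ) (hm : (m : R) = 0) (i : ℕ)
    (g : LinearMap.GeneralLinearGroup R V) (x : Term R V m i) :
    diff R V m hm i (hookRep R V _ _ g x) = hookRep R V _ _ g (diff R V m hm i x) := by
  obtain ⟨⟨y, hy⟩, rfl⟩ := Submodule.Quotient.mk_surjective _ x
  refine congrArg (Submodule.Quotient.mk (p := hookRel R V ((m : ℤ) - (i + 1 : ℕ)) (i + 1))) ?_
  exact Subtype.ext (ambientRep_phi g hy).symm

/-- The coboundaries in degree `i`: the image of the differential that ends in
`S_{(m-i,1ⁱ)}(V)`, whose source is `0` for `i = 0`. -/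
def coboundaries (m : ℕ) (hm : (m : R) = 0) : (i : ℕ) → Submodule R (Term R V m i)
  | 0 => ⊥
  | i + 1 => LinearMap.range (diff R V m hm i)

/-- The cocycles in degree `i`. -/
def cocycles (m : ℕ) (hm : (m : R) = 0) (i : ℕ) : Submodule R (Term R V m i) :=
  LinearMap.ker (diff R V m hm i)

/-- The cohomology `Hⁱ(N_m(V))`. -/
abbrev Cohomology (m : ℕ) (hm : (m : R) = 0) (i : ℕ) : Type (max u w) :=
  cocycles R V m hm i ⧸ (coboundaries R V m hm i).submoduleOf (cocycles R V m hm i)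

/-- The action of `GL(V)` on the cohomology `Hⁱ(N_m(V))`. -/
def cohomologyRep (m : ℕ) (hm : (m : R) = 0) (i : ℕ) :
    Representation R (LinearMap.GeneralLinearGroup R V) (Cohomology R V m hm i) :=
  ((hookRep R V ((m : ℤ) - i) i).subrepresentation (cocycles R V m hm i) fun g x hx => by
    have hx' : diff R V m hm i x = 0 := hx
    change diff R V m hm i _ = 0
    rw [diff_hookRep, hx', map_zero]).quotient _ (by
      rintro g ⟨x, hx⟩ hx'
      change x ∈ coboundaries R V m hm i at hx'
      change hookRep R V _ _ g x ∈ coboundaries R V m hm i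
      cases i with
      | zero =>
        have : x = 0 := hx'
        rw [this, map_zero]
        exact zero_mem _
      | succ i =>
        obtain ⟨z, rfl⟩ := hx'
        exact ⟨hookRep R V _ _ g z, diff_hookRep R V m hm i g z⟩)

/-! ### Frobenius twists -/

section frobenius

variable (p : ℕ) [ExpChar R p]

/-- The ring `R`, regarded as an `R`-algebra through the Frobenius endomorphism `r ↦ rᵖ`. -/
def FrobRing (_ : ℕ) : Type u := R

instance : CommRing (FrobRing R p) := inferInstanceAs (CommRing R)

instance : Algebra R (FrobRing R p) := (frobenius R p).toAlgebra

variable (W : Type w) [AddCommGroup W] [Module R W]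

/-- The Frobenius power `FᵖW`: the base change of `W` along the Frobenius endomorphism of `R`. -/
def FrobTwist : Type (max u w) := FrobRing R p ⊗[R] W

instance : AddCommGroup (FrobTwist R p W) :=
  inferInstanceAs (AddCommGroup (FrobRing R p ⊗[R] W))

/-- The scalars act on the left factor, so that `1 ⊗ (r w) = rᵖ (1 ⊗ w)`. -/
instance : Module R (FrobTwist R p W) :=
  inferInstanceAs (Module (FrobRing R p) (FrobRing R p ⊗[R] W))

variable {R} {W}

/-- The canonical map `W → FᵖW`, `w ↦ 1 ⊗ w`. -/
def FrobTwist.of (w : W) : FrobTwist R p W := (1 : FrobRing R p) ⊗ₜ[R] w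

theorem FrobTwist.of_smul (r : R) (w : W) :
    FrobTwist.of (R := R) p (r • w) = r ^ p • FrobTwist.of (R := R) p w := by
  let s : FrobRing R p := frobenius R p r
  have h : r • (1 : FrobRing R p) = s • (1 : FrobRing R p) := by
    rw [Algebra.smul_def]; rfl
  change (1 : FrobRing R p) ⊗ₜ[R] (r • w) = s • ((1 : FrobRing R p) ⊗ₜ[R] w)
  rw [← TensorProduct.smul_tmul, h, TensorProduct.smul_tmul']

/-- The representation on `FᵖW` induced by a representation on `W`: `g (1 ⊗ w) = 1 ⊗ g w`. -/
def frobTwistRep {G : Type*} [Monoid G] (ρ : Representation R G W) :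
    Representation R G (FrobTwist R p W) where
  toFun g := ((ρ g).baseChange (FrobRing R p) :
    FrobRing R p ⊗[R] W →ₗ[FrobRing R p] FrobRing R p ⊗[R] W)
  map_one' := by
    rw [map_one]
    exact LinearMap.baseChange_id
  map_mul' g h := by
    rw [map_mul]
    exact LinearMap.baseChange_comp _ _

end frobenius

end HookComplex

end

noncomputable section

namespace HookComplex

universe u w v

variable {R : Type u} [CommRing R] {V : Type w} [AddCommGroup V] [Module R V]

/-! ### Operator identities on `⋀ V ⊗ S(V)` -/

/-! Regard `⋀ V ⊗ S(V)` as the polynomial differential forms in coordinates `x_k`, where the `x_k`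
form a basis of `V`. Up to sign, `φ` is the de Rham differential and `κ` is contraction with the
Euler field. The `i`-th term of `N_m(V)` consists of the `(i+1)`-forms of total degree `m` modulo
the image of `κ`. The isomorphism is a version of Cartier's theorem modulo `κ`. The inverse Cartier
operator `C` is Frobenius semilinear with `x_k ↦ x_k ^ p` and `dx_k ↦ x_k ^ (p - 1) dx_k`. Its
values are closed, it multiplies total degrees by `p`, and it commutes with `κ` because `κ (x_k ^ (p
- 1) dx_k) = x_k ^ p`. With `n = m / p` it therefore induces the map `comparison` from
`FᵖS_{(n-i,1ⁱ)}(V)` to `Hⁱ(N_m(V))`.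

Bijectivity comes from the multidegree that counts `x_k` and `dx_k` alike, which `φ` and `κ`
preserve. In a multidegree `α` with `p ∤ α_k`, Cartan's formula makes `α_k⁻¹ x_k ∂/∂(dx_k)` a
contracting homotopy, and this operator anticommutes with `κ`. Together these give `h` with `φ h + h
φ = 1 - π` (`phi_homotopy_add`, `homotopy_kappa`), where `π` projects onto the multidegrees
divisible by `p`. Those are spanned by the values of `C` on monomials, so `φ` vanishes on them. If
`φ z = κ u`, then `z = π z + φ h z - κ h u`, which gives surjectivity. For injectivity,
`cartierRetract` inverts `C` on the left and kills both the exact forms and the relevant part of the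
image of `κ`.

Two points remain. `C` depends on the basis, but only up to exact forms: `((v + w) ^ p - v ^ p - w ^
p) / p` is an integral polynomial whose differential measures the failure of additivity of `v ↦ v ^
(p - 1) dv` (`mulSym_pow_mulExt_add_sub_mem_range`, `cartier_ambientRep_sub_mem_range`). In degree
`0` there are no coboundaries, although functions have differentials; these vanish modulo `κ`
because `m = 0` in `R` (`phi_mem_map_kappa`). -/

theorem mulExt_mulSym (v w : V) (y : Ambient R V) :
    mulExt R v (mulSym R w y) = mulSym R w (mulExt R v y) := mulExtT_mulSymT v w y

theorem mulExt_self (v : V) (y : Ambient R V) : mulExt R v (mulExt R v y) = 0 := by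
  change ExteriorAlgebra R V ⊗[R] SymmetricAlgebra R V at y
  change mulExtT R v (mulExtT R v y) = 0
  induction y using TensorProduct.induction_on with
  | zero => simp
  | add x y hx hy => simp only [map_add, hx, hy, add_zero]
  | tmul x s => simp [mul_assoc]

theorem mulSym_mulSym (v w : V) (y : Ambient R V) :
    mulSym R v (mulSym R w y) = mulSym R w (mulSym R v y) := by
  change ExteriorAlgebra R V ⊗[R] SymmetricAlgebra R V at y
  change mulSymT R v (mulSymT R w y) = mulSymT R w (mulSymT R v y)
  induction y using TensorProduct.induction_on with
  | zero => simp
  | add x y hx hy => simp only [map_add, hx, hy]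
  | tmul x s => simp [mul_left_comm]

theorem mulSym_add (v w : V) : mulSym R (v + w) = mulSym R v + mulSym R w := by
  refine TensorProduct.ext' fun x s => ?_
  change mulSymT R (v + w) (x ⊗ₜ s) = mulSymT R v (x ⊗ₜ s) + mulSymT R w (x ⊗ₜ s)
  simp [add_mul, TensorProduct.tmul_add]

theorem mulSym_smul (r : R) (v : V) : mulSym R (r • v) = r • mulSym R v := by
  refine TensorProduct.ext' fun x s => ?_
  change mulSymT R (r • v) (x ⊗ₜ s) = r • mulSymT R v (x ⊗ₜ s)
  simp

theorem mulExt_add (v w : V) : mulExt R (v + w) = mulExt R v + mulExt R w := by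
  refine TensorProduct.ext' fun x s => ?_
  change mulExtT R (v + w) (x ⊗ₜ s) = mulExtT R v (x ⊗ₜ s) + mulExtT R w (x ⊗ₜ s)
  simp [mul_add, TensorProduct.add_tmul]

theorem mulExt_smul (r : R) (v : V) : mulExt R (r • v) = r • mulExt R v := by
  refine TensorProduct.ext' fun x s => ?_
  change mulExtT R (r • v) (x ⊗ₜ s) = r • mulExtT R v (x ⊗ₜ s)
  simp [TensorProduct.smul_tmul']

theorem commute_mulSym (v w : V) : Commute (mulSym R v) (mulSym R w) :=
  LinearMap.ext fun y => mulSym_mulSym v w y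

theorem mulExt_mulSym_pow (v w : V) (n : ℕ) (y : Ambient R V) :
    mulExt R v ((mulSym R w ^ n) y) = (mulSym R w ^ n) (mulExt R v y) := by
  have h : Commute (mulExt R v) (mulSym R w) := LinearMap.ext fun y => mulExt_mulSym v w y
  exact congr($((h.pow_right n).eq) y)

theorem kappa_mulSym_pow (v : V) (n : ℕ) (y : Ambient R V) :
    kappa R V ((mulSym R v ^ n) y) = (mulSym R v ^ n) (kappa R V y) := by
  have h : Commute (kappa R V) (mulSym R v) := LinearMap.ext fun y => kappa_mulSym v y
  exact congr($((h.pow_right n).eq) y)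

/-- The Leibniz rule for `v ^ n y`. The truncated exponent `n - 1` is harmless at `n = 0`, where its
coefficient vanishes. -/
theorem phi_mulSym_pow (v : V) (n : ℕ) (y : Ambient R V) :
    phi R V ((mulSym R v ^ n) y) =
      (mulSym R v ^ n) (phi R V y) + n • (mulSym R v ^ (n - 1)) (mulExt R v y) := by
  induction n with
  | zero => simp
  | succ n ih =>
    rw [pow_succ', Module.End.mul_apply, phi_mulSym, ih, mulExt_mulSym_pow, map_add, map_nsmul]
    cases n with
    | zero => simp [add_comm]
    | succ n =>
      rw [Nat.add_sub_cancel, Nat.add_sub_cancel, succ_nsmul' _ (n + 1),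
        ← Module.End.mul_apply (mulSym R v) (mulSym R v ^ (n + 1)), ← pow_succ',
        ← Module.End.mul_apply (mulSym R v) (mulSym R v ^ n), ← pow_succ']
      abel

/-- The form `v ^ n dv` is closed for every `n`, since `dv ∧ dv = 0`; the case `n = p - 1` is the
one needed. -/
theorem phi_mulSym_pow_mulExt (v : V) (n : ℕ) (y : Ambient R V) :
    phi R V ((mulSym R v ^ n) (mulExt R v y)) =
      - (mulSym R v ^ n) (mulExt R v (phi R V y)) := by
  rw [phi_mulSym_pow, mulExt_self, map_zero, smul_zero, add_zero, phi_mulExt, map_neg]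

theorem ambientRep_mulSym_pow (g : LinearMap.GeneralLinearGroup R V) (v : V) (n : ℕ)
    (y : Ambient R V) :
    ambientRep R V g ((mulSym R v ^ n) y) =
      (mulSym R ((g : V →ₗ[R] V) v) ^ n) (ambientRep R V g y) := by
  induction n with
  | zero => simp
  | succ n ih =>
    rw [pow_succ', pow_succ', Module.End.mul_apply, ambientRep_mulSym, ih, Module.End.mul_apply]

/-- The contraction of `⋀ V` with a linear form, extended to `⋀ V ⊗ S(V)`. -/
def contrT (f : Module.Dual R V) : ExteriorAlgebra R V ⊗[R] SymmetricAlgebra R V →ₗ[R]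
    ExteriorAlgebra R V ⊗[R] SymmetricAlgebra R V :=
  (CliffordAlgebra.contractRight.flip f :
    ExteriorAlgebra R V →ₗ[R] ExteriorAlgebra R V).rTensor (SymmetricAlgebra R V)

theorem contrT_tmul (f : Module.Dual R V) (x : ExteriorAlgebra R V) (s : SymmetricAlgebra R V) :
    contrT f (x ⊗ₜ[R] s) = (CliffordAlgebra.contractRight x f : ExteriorAlgebra R V) ⊗ₜ[R] s :=
  rfl

theorem contrT_mulSymT (f : Module.Dual R V) (v : V)
    (y : ExteriorAlgebra R V ⊗[R] SymmetricAlgebra R V) :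
    contrT f (mulSymT R v y) = mulSymT R v (contrT f y) := by
  induction y using TensorProduct.induction_on with
  | zero => simp only [map_zero]
  | add x y hx hy => simp only [map_add, hx, hy]
  | tmul x s => rfl

theorem contrT_mulExtT (f : Module.Dual R V) (v : V)
    (y : ExteriorAlgebra R V ⊗[R] SymmetricAlgebra R V) :
    contrT f (mulExtT R v y) = f v • y - mulExtT R v (contrT f y) := by
  induction y using TensorProduct.induction_on with
  | zero => simp only [map_zero, smul_zero, sub_zero]
  | add x y hx hy => simp only [map_add, hx, hy, smul_add]; abel
  | tmul x s =>
    have h : (CliffordAlgebra.contractRight (x * ExteriorAlgebra.ι R v) f : ExteriorAlgebra R V) =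
        f v • x - (CliffordAlgebra.contractRight x f : ExteriorAlgebra R V) *
          ExteriorAlgebra.ι R v :=
      CliffordAlgebra.contractRight_mul_ι (Q := (0 : QuadraticForm R V)) f v x
    rw [mulExtT_tmul, contrT_tmul, contrT_tmul, mulExtT_tmul, h, TensorProduct.smul_tmul',
      TensorProduct.sub_tmul]

/-- The contraction of `⋀ V ⊗ S(V)` with a linear form. -/
def contr (f : Module.Dual R V) : Ambient R V →ₗ[R] Ambient R V := contrT f

theorem contr_one (f : Module.Dual R V) : contr f (tmul R V 1 1) = 0 := by
  change (CliffordAlgebra.contractRight (1 : ExteriorAlgebra R V) f) ⊗ₜ[R]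
    (1 : SymmetricAlgebra R V) = 0
  rw [CliffordAlgebra.contractRight_one, TensorProduct.zero_tmul]

theorem contr_mulSym (f : Module.Dual R V) (v : V) (y : Ambient R V) :
    contr f (mulSym R v y) = mulSym R v (contr f y) := contrT_mulSymT f v y

theorem contr_mulExt (f : Module.Dual R V) (v : V) (y : Ambient R V) :
    contr f (mulExt R v y) = f v • y - mulExt R v (contr f y) := contrT_mulExtT f v y

theorem contr_mem (f : Module.Dual R V) {i : ℕ} {j : ℤ} {y : Ambient R V}
    (hy : y ∈ piece R V (i + 1) j) : contr f y ∈ piece R V i j := by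
  -- `N` is the target bidegree, set to zero in exterior degree `0`, where a contraction must
  -- vanish. Membership of `y` itself is carried along because of the term `f v • y`.
  let N : ℕ → ℤ → Submodule R (Ambient R V) := fun i j =>
    match i with
    | 0 => ⊥
    | i + 1 => piece R V i j
  refine (piece_induction
    (P := fun i j => piece R V i j ⊓ (N i j).comap (contr f)) ?_ ?_ ?_ (i + 1) j hy).2
  · exact Submodule.mem_inf.2 ⟨one_mem, by rw [Submodule.mem_comap, contr_one]; exact zero_mem _⟩
  · intro i v y h
    obtain ⟨hy, hy'⟩ := Submodule.mem_inf.1 h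
    refine Submodule.mem_inf.2 ⟨mulExt_mem v hy, ?_⟩
    rw [Submodule.mem_comap] at hy' ⊢
    rw [contr_mulExt]
    refine sub_mem (Submodule.smul_mem _ _ hy) ?_
    cases i with
    | zero => rw [(Submodule.mem_bot R).1 hy', map_zero]; exact zero_mem _
    | succ i => exact mulExt_mem v hy'
  · intro i n v y h
    obtain ⟨hy, hy'⟩ := Submodule.mem_inf.1 h
    have e1 : ((n + 1 : ℕ) : ℤ) = n + 1 := by push_cast; ring
    rw [e1]
    refine Submodule.mem_inf.2 ⟨mulSym_mem v hy, ?_⟩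
    rw [Submodule.mem_comap] at hy' ⊢
    rw [contr_mulSym]
    cases i with
    | zero => rw [(Submodule.mem_bot R).1 hy', map_zero]; exact zero_mem _
    | succ i => exact mulSym_mem v hy'

theorem kappa_mem {i : ℕ} {j : ℤ} {y : Ambient R V}
    (hy : y ∈ piece R V (i + 1) j) : kappa R V y ∈ piece R V i (j + 1) := by
  let N : ℕ → ℤ → Submodule R (Ambient R V) := fun i j =>
    match i with
    | 0 => ⊥
    | i + 1 => piece R V i (j + 1)
  refine (piece_induction
    (P := fun i j => piece R V i j ⊓ (N i j).comap (kappa R V)) ?_ ?_ ?_ (i + 1) j hy).2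
  · exact Submodule.mem_inf.2 ⟨one_mem, by rw [Submodule.mem_comap, kappa_one]; exact zero_mem _⟩
  · intro i v y h
    obtain ⟨hy, hy'⟩ := Submodule.mem_inf.1 h
    refine Submodule.mem_inf.2 ⟨mulExt_mem v hy, ?_⟩
    rw [Submodule.mem_comap] at hy' ⊢
    rw [kappa_mulExt]
    refine sub_mem (mulSym_mem v hy) ?_
    cases i with
    | zero => rw [(Submodule.mem_bot R).1 hy', map_zero]; exact zero_mem _
    | succ i => exact mulExt_mem v hy'
  · intro i n v y h
    obtain ⟨hy, hy'⟩ := Submodule.mem_inf.1 h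
    have e1 : ((n + 1 : ℕ) : ℤ) = n + 1 := by push_cast; ring
    rw [e1]
    refine Submodule.mem_inf.2 ⟨mulSym_mem v hy, ?_⟩
    rw [Submodule.mem_comap] at hy' ⊢
    rw [kappa_mulSym]
    cases i with
    | zero => rw [(Submodule.mem_bot R).1 hy', map_zero]; exact zero_mem _
    | succ i => exact mulSym_mem v hy'

/-! ### Monomial bases -/

section monomials

variable {ι : Type v} (b : Module.Basis ι R V)

theorem symmetricAlgebra_basis_apply (γ : ι →₀ ℕ) :
    b.symmetricAlgebra γ =
      (SymmetricAlgebra.equivMvPolynomial b).symm (MvPolynomial.monomial γ 1) := by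
  simp [Module.Basis.symmetricAlgebra]

theorem mulExt_mem_of_basis {N N' : Submodule R (Ambient R V)}
    (h : ∀ k, ∀ y ∈ N, mulExt R (b k) y ∈ N') (v : V) {y : Ambient R V} (hy : y ∈ N) :
    mulExt R v y ∈ N' := by
  induction b.mem_span v using Submodule.span_induction with
  | zero => rw [← zero_smul R (0 : V), mulExt_smul, zero_smul]; exact N'.zero_mem
  | mem v hv => obtain ⟨k, rfl⟩ := hv; exact h k y hy
  | add v w _ _ hv hw => rw [mulExt_add]; exact add_mem hv hw
  | smul r v _ hv => rw [mulExt_smul]; exact N'.smul_mem r hv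

theorem mulSym_mem_of_basis {N N' : Submodule R (Ambient R V)}
    (h : ∀ k, ∀ y ∈ N, mulSym R (b k) y ∈ N') (v : V) {y : Ambient R V} (hy : y ∈ N) :
    mulSym R v y ∈ N' := by
  induction b.mem_span v using Submodule.span_induction with
  | zero => rw [← zero_smul R (0 : V), mulSym_smul, zero_smul]; exact N'.zero_mem
  | mem v hv => obtain ⟨k, rfl⟩ := hv; exact h k y hy
  | add v w _ _ hv hw => rw [mulSym_add]; exact add_mem hv hw
  | smul r v _ hv => rw [mulSym_smul]; exact N'.smul_mem r hv

variable [LinearOrder ι]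

/-- The basis of `⋀ V ⊗ S(V)` by the products of an exterior and a symmetric monomial in the
vectors of a basis of `V`. -/
def monomials : Module.Basis (Finset ι × (ι →₀ ℕ)) R (Ambient R V) :=
  (b.ExteriorAlgebra.tensorProduct b.symmetricAlgebra : Module.Basis _ R
    (ExteriorAlgebra R V ⊗[R] SymmetricAlgebra R V))

theorem monomials_apply (J : Finset ι) (γ : ι →₀ ℕ) :
    monomials b (J, γ) = tmul R V (b.ExteriorAlgebra J) (b.symmetricAlgebra γ) :=
  Module.Basis.tensorProduct_apply _ _ _ _

theorem monomials_zero : monomials b (∅, 0) = tmul R V 1 1 := by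
  rw [monomials_apply, symmetricAlgebra_basis_apply, ExteriorAlgebra.basis_apply]
  simp

theorem mulSym_monomials (k : ι) (J : Finset ι) (γ : ι →₀ ℕ) :
    mulSym R (b k) (monomials b (J, γ)) = monomials b (J, γ + Finsupp.single k 1) := by
  rw [monomials_apply, monomials_apply, mulSym_tmul, symmetricAlgebra_basis_apply,
    symmetricAlgebra_basis_apply, ← SymmetricAlgebra.equivMvPolynomial_symm_X, ← map_mul,
    MvPolynomial.X, MvPolynomial.monomial_mul, one_mul, add_comm]

theorem mulSym_pow_monomials (k : ι) (n : ℕ) (J : Finset ι) (γ : ι →₀ ℕ) :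
    (mulSym R (b k) ^ n) (monomials b (J, γ)) = monomials b (J, γ + Finsupp.single k n) := by
  induction n with
  | zero => simp
  | succ n ih =>
    rw [pow_succ', Module.End.mul_apply, ih, mulSym_monomials, add_assoc, ← Finsupp.single_add]

theorem exteriorAlgebra_basis_singleton (k : ι) :
    b.ExteriorAlgebra {k} = ExteriorAlgebra.ι R (b k) := by
  rw [ExteriorAlgebra.basis_apply_ofCard b (n := 1) (Finset.card_singleton k)]
  simp only [ExteriorAlgebra.ιMulti_family, ExteriorAlgebra.ιMulti_apply]
  have h : ∀ x : Fin 1, (Set.powersetCard.ofFinEmbEquiv.symm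
      (Set.powersetCard.ofCard (Finset.card_singleton k))) x = k := fun x => by
    have := (Set.powersetCard.mem_range_ofFinEmbEquiv_symm_iff_mem
      (Set.powersetCard.ofCard (Finset.card_singleton k)) _).1 (Set.mem_range_self x)
    exact Finset.mem_singleton.1 this
  simp [h]

theorem mulExt_monomials_of_mem {k : ι} {J : Finset ι} (hk : k ∈ J) (γ : ι →₀ ℕ) :
    mulExt R (b k) (monomials b (J, γ)) = 0 := by
  rw [monomials_apply, mulExt_tmul, ← exteriorAlgebra_basis_singleton]
  have := ExteriorAlgebra.basis_mul_of_not_disjoint b (Set.powersetCard.ofCard (s := J) rfl)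
    (Set.powersetCard.ofCard (Finset.card_singleton k)) (by simpa using hk)
  rw [show b.ExteriorAlgebra J * b.ExteriorAlgebra {k} = 0 from this, map_zero,
    LinearMap.zero_apply]

/-- What matters is that the sign is independent of `γ`: `cartier_mulExt_basis` uses the same sign
for a monomial and for its image under `cartier`. -/
theorem exists_mulExt_monomials {k : ι} {J : Finset ι} (hk : k ∉ J) :
    ∃ ε : ℤ, ε * ε = 1 ∧ ∀ γ : ι →₀ ℕ,
      mulExt R (b k) (monomials b (J, γ)) = ε • monomials b (insert k J, γ) := by
  have h : Disjoint (Set.powersetCard.ofCard (s := J) rfl).val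
    (Set.powersetCard.ofCard (Finset.card_singleton k)).val := by simpa using hk
  refine ⟨((Set.powersetCard.permOfDisjoint h).sign : ℤˣ), by
    rw [← Units.val_mul, Int.units_mul_self, Units.val_one], fun γ => ?_⟩
  have := ExteriorAlgebra.basis_mul_of_disjoint b _ _ h
  have e : ((Set.powersetCard.disjUnion h : Set.powersetCard ι _) : Finset ι) = insert k J := by
    ext a
    simp [Set.powersetCard.disjUnion]
  rw [e] at this
  rw [monomials_apply, monomials_apply, mulExt_tmul, ← exteriorAlgebra_basis_singleton]
  rw [show b.ExteriorAlgebra J * b.ExteriorAlgebra {k} = _ from this, Units.smul_def,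
    map_zsmul, LinearMap.smul_apply]

/-- To prove a property of the monomials, it suffices to multiply by one basis vector at a
time. -/
theorem monomials_induction {P : Finset ι → (ι →₀ ℕ) → Submodule R (Ambient R V)}
    (one : tmul R V 1 1 ∈ P ∅ 0)
    (ext : ∀ J, ∀ k ∉ J, monomials b (J, 0) ∈ P J 0 →
      mulExt R (b k) (monomials b (J, 0)) ∈ P (insert k J) 0)
    (sym : ∀ J γ k, monomials b (J, γ) ∈ P J γ →
      mulSym R (b k) (monomials b (J, γ)) ∈ P J (γ + Finsupp.single k 1))
    (J : Finset ι) (γ : ι →₀ ℕ) : monomials b (J, γ) ∈ P J γ := by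
  have h0 : monomials b (J, 0) ∈ P J 0 := by
    induction J using Finset.induction_on with
    | empty => rwa [monomials_zero]
    | insert k J hk ih =>
      obtain ⟨ε, hε, h⟩ := exists_mulExt_monomials b hk
      have h1 := (P (insert k J) 0).smul_of_tower_mem ε (ext J k hk ih)
      rwa [h, smul_smul, hε, one_smul] at h1
  -- The starting exponent `γ'` stays arbitrary so that the summands of `γ` can be added in turn.
  suffices ∀ γ', monomials b (J, γ') ∈ P J γ' → monomials b (J, γ' + γ) ∈ P J (γ' + γ) by
    simpa using this 0 h0
  induction γ using Finsupp.induction_linear with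
  | zero => intro γ' h; simpa using h
  | add γ₁ γ₂ h₁ h₂ => intro γ' h; rw [← add_assoc]; exact h₂ _ (h₁ _ h)
  | single k n =>
    induction n with
    | zero => intro γ' h; simpa using h
    | succ n ih =>
      intro γ' h
      have := sym J _ k (ih γ' h)
      rwa [mulSym_monomials, add_assoc, ← Finsupp.single_add] at this

/-- A submodule that contains `1` and is stable under the multiplications by basis vectors is
everything. -/
theorem eq_top_of_mulExt_of_mulSym {N : Submodule R (Ambient R V)} (one : tmul R V 1 1 ∈ N)
    (ext : ∀ k, ∀ y ∈ N, mulExt R (b k) y ∈ N) (sym : ∀ k, ∀ y ∈ N, mulSym R (b k) y ∈ N) :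
    N = ⊤ := by
  rw [eq_top_iff, ← (monomials b).span_eq, Submodule.span_le]
  rintro _ ⟨⟨J, γ⟩, rfl⟩
  exact monomials_induction b (P := fun _ _ => N) one (fun J k _ => ext k _)
    (fun J γ k => sym k _) J γ

theorem monomials_mem_piece {J : Finset ι} {γ : ι →₀ ℕ} {i : ℕ} {j : ℤ} (hi : J.card = i)
    (hj : (γ.degree : ℤ) = j) : monomials b (J, γ) ∈ piece R V i j := by
  subst hi hj
  refine monomials_induction b (P := fun J γ => piece R V J.card γ.degree) ?_ ?_ ?_ J γ
  · simpa using one_mem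
  · intro J k hk h
    rw [Finset.card_insert_of_notMem hk]
    exact mulExt_mem _ h
  · intro J γ k h
    rw [map_add, Finsupp.degree_single]
    exact_mod_cast mulSym_mem (b k) h

/-- The span of the monomials whose index lies in `s`. -/
def monomialSpan (s : Set (Finset ι × (ι →₀ ℕ))) : Submodule R (Ambient R V) :=
  Submodule.span R (monomials b '' s)

theorem monomials_mem_span {s : Set (Finset ι × (ι →₀ ℕ))} {t} (ht : t ∈ s) :
    monomials b t ∈ monomialSpan b s :=
  Submodule.subset_span ⟨t, ht, rfl⟩

theorem monomialSpan_le {s : Set (Finset ι × (ι →₀ ℕ))} {N : Submodule R (Ambient R V)}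
    (h : ∀ t ∈ s, monomials b t ∈ N) : monomialSpan b s ≤ N := by
  refine Submodule.span_le.2 ?_
  rintro _ ⟨t, ht, rfl⟩
  exact h t ht

theorem mulSym_mem_monomialSpan {s s' : Set (Finset ι × (ι →₀ ℕ))} (k : ι)
    (h : ∀ J γ, (J, γ) ∈ s → (J, γ + Finsupp.single k 1) ∈ s') {y : Ambient R V}
    (hy : y ∈ monomialSpan b s) : mulSym R (b k) y ∈ monomialSpan b s' := by
  refine monomialSpan_le b (N := (monomialSpan b s').comap (mulSym R (b k))) ?_ hy
  rintro ⟨J, γ⟩ ht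
  rw [Submodule.mem_comap, mulSym_monomials]
  exact monomials_mem_span b (h J γ ht)

theorem mulExt_mem_monomialSpan {s s' : Set (Finset ι × (ι →₀ ℕ))} (k : ι)
    (h : ∀ J γ, k ∉ J → (J, γ) ∈ s → (insert k J, γ) ∈ s') {y : Ambient R V}
    (hy : y ∈ monomialSpan b s) : mulExt R (b k) y ∈ monomialSpan b s' := by
  refine monomialSpan_le b (N := (monomialSpan b s').comap (mulExt R (b k))) ?_ hy
  rintro ⟨J, γ⟩ ht
  rw [Submodule.mem_comap]
  by_cases hk : k ∈ J
  · rw [mulExt_monomials_of_mem b hk]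
    exact zero_mem _
  · obtain ⟨ε, -, hε⟩ := exists_mulExt_monomials b hk
    rw [hε]
    exact Submodule.smul_of_tower_mem _ ε (monomials_mem_span b (h J γ hk ht))

theorem piece_le_monomialSpan (i : ℕ) (j : ℤ) :
    piece R V i j ≤ monomialSpan b {t | t.1.card = i ∧ (t.2.degree : ℤ) = j} := by
  refine piece_induction (P := fun i j =>
    monomialSpan b {t | t.1.card = i ∧ (t.2.degree : ℤ) = j}) ?_ ?_ ?_ i j
  · rw [← monomials_zero b]
    exact monomials_mem_span b (by simp)
  · intro i v y hy
    refine mulExt_mem_of_basis b (fun k y hy => mulExt_mem_monomialSpan b k ?_ hy) v hy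
    rintro J γ hk ⟨h1, h2⟩
    exact ⟨by rw [Finset.card_insert_of_notMem hk, h1], h2⟩
  · intro i n v y hy
    refine mulSym_mem_of_basis b (fun k y hy => mulSym_mem_monomialSpan b k ?_ hy) v hy
    rintro J γ ⟨h1, h2⟩
    refine ⟨h1, ?_⟩
    simp only at h2
    simp only [map_add, Finsupp.degree_single]
    omega

end monomials

section

variable {ι : Type v} (b : Module.Basis ι R V)

/-! ### Multidegrees and the contracting homotopies -/

/-- The multidegree of a monomial, in which `v` and `dv` both have degree one. -/
def weight (t : Finset ι × (ι →₀ ℕ)) : ι →₀ ℕ :=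
  t.2 + ∑ k ∈ t.1, Finsupp.single k 1

theorem weight_add_single (J : Finset ι) (γ : ι →₀ ℕ) (k : ι) (n : ℕ) :
    weight (J, γ + Finsupp.single k n) = weight (J, γ) + Finsupp.single k n := by
  simp only [weight]
  abel

open Classical in
theorem weight_apply (J : Finset ι) (γ : ι →₀ ℕ) (k : ι) :
    weight (J, γ) k = γ k + if k ∈ J then 1 else 0 := by
  simp [weight, Finsupp.single_apply]

/-- The operator `x_k ∂/∂(dx_k)`. -/
def partialHomotopy (k : ι) : Ambient R V →ₗ[R] Ambient R V :=
  mulSym R (b k) ∘ₗ contr (b.coord k)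

theorem partialHomotopy_one (k : ι) : partialHomotopy b k (tmul R V 1 1) = 0 := by
  rw [partialHomotopy, LinearMap.comp_apply, contr_one, map_zero]

theorem partialHomotopy_mulSym (k : ι) (v : V) (y : Ambient R V) :
    partialHomotopy b k (mulSym R v y) = mulSym R v (partialHomotopy b k y) := by
  simp only [partialHomotopy, LinearMap.comp_apply, contr_mulSym]
  exact mulSym_mulSym _ _ _

theorem partialHomotopy_mulExt (k : ι) (v : V) (y : Ambient R V) :
    partialHomotopy b k (mulExt R v y) =
      b.coord k v • mulSym R (b k) y - mulExt R v (partialHomotopy b k y) := by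
  simp only [partialHomotopy, LinearMap.comp_apply, contr_mulExt, map_sub, map_smul,
    mulExt_mulSym]

theorem partialHomotopy_mem (k : ι) {i : ℕ} {j : ℤ} {y : Ambient R V}
    (hy : y ∈ piece R V (i + 1) j) : partialHomotopy b k y ∈ piece R V i (j + 1) :=
  mulSym_mem _ (contr_mem _ hy)

variable [LinearOrder ι]

theorem weight_insert {k : ι} {J : Finset ι} (hk : k ∉ J) (γ : ι →₀ ℕ) :
    weight (insert k J, γ) = weight (J, γ) + Finsupp.single k 1 := by
  simp only [weight]
  rw [Finset.sum_insert hk]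
  abel

/-- Both operators are contractions with vector fields, the Euler field and `x_k ∂/∂x_k`, and
contractions anticommute. This lets the homotopy act modulo the image of `κ`. -/
theorem kappa_partialHomotopy (k : ι) (y : Ambient R V) :
    kappa R V (partialHomotopy b k y) = - partialHomotopy b k (kappa R V y) := by
  suffices h : LinearMap.eqLocus (kappa R V ∘ₗ partialHomotopy b k)
      (- (partialHomotopy b k ∘ₗ kappa R V)) = ⊤ from
    LinearMap.mem_eqLocus.1 (h.ge (Submodule.mem_top (x := y)))
  refine eq_top_of_mulExt_of_mulSym b ?_ ?_ ?_
  · simp [kappa_one, partialHomotopy_one]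
  · intro j y hy
    simp only [LinearMap.mem_eqLocus, LinearMap.neg_apply, LinearMap.comp_apply] at hy ⊢
    simp only [kappa_mulExt, partialHomotopy_mulExt, map_sub, map_smul, kappa_mulSym,
      partialHomotopy_mulSym, hy, map_neg]
    abel
  · intro j y hy
    simp only [LinearMap.mem_eqLocus, LinearMap.neg_apply, LinearMap.comp_apply] at hy ⊢
    simp only [kappa_mulSym, partialHomotopy_mulSym, hy, map_neg]

include b in
theorem phi_phi (y : Ambient R V) : phi R V (phi R V y) = 0 := by
  suffices h : LinearMap.ker (phi R V ∘ₗ phi R V) = ⊤ from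
    LinearMap.mem_ker.1 (h.ge (Submodule.mem_top (x := y)))
  refine eq_top_of_mulExt_of_mulSym b ?_ ?_ ?_
  · simp [phi_one]
  · intro j y hy
    simp only [LinearMap.mem_ker, LinearMap.comp_apply] at hy ⊢
    simp only [phi_mulExt, map_neg, hy, map_zero, neg_zero]
  · intro j y hy
    simp only [LinearMap.mem_ker, LinearMap.comp_apply] at hy ⊢
    simp only [phi_mulSym, map_add, phi_mulExt, hy, map_zero, neg_add_cancel, add_zero]

/-- The multihomogeneous component of `⋀ V ⊗ S(V)` of multidegree `α`. -/
def weightSpace (α : ι →₀ ℕ) : Submodule R (Ambient R V) :=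
  monomialSpan b {t | weight t = α}

theorem monomials_mem_weightSpace (t : Finset ι × (ι →₀ ℕ)) :
    monomials b t ∈ weightSpace b (weight t) :=
  monomials_mem_span b rfl

theorem mulSym_mem_weightSpace (k : ι) {α : ι →₀ ℕ} {y : Ambient R V}
    (hy : y ∈ weightSpace b α) : mulSym R (b k) y ∈ weightSpace b (α + Finsupp.single k 1) := by
  refine mulSym_mem_monomialSpan b k ?_ hy
  rintro J γ rfl
  exact weight_add_single J γ k 1

theorem mulExt_mem_weightSpace (k : ι) {α : ι →₀ ℕ} {y : Ambient R V}
    (hy : y ∈ weightSpace b α) : mulExt R (b k) y ∈ weightSpace b (α + Finsupp.single k 1) := by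
  refine mulExt_mem_monomialSpan b k ?_ hy
  rintro J γ hk rfl
  exact weight_insert hk γ

theorem phi_monomials_mem (t : Finset ι × (ι →₀ ℕ)) :
    phi R V (monomials b t) ∈ weightSpace b (weight t) := by
  refine monomials_induction b
    (P := fun J γ => (weightSpace b (weight (J, γ))).comap (phi R V)) ?_ ?_ ?_ t.1 t.2
  · rw [Submodule.mem_comap, phi_one]
    exact zero_mem _
  · intro J k hk h
    rw [Submodule.mem_comap, phi_mulExt, weight_insert hk]
    exact neg_mem (mulExt_mem_weightSpace b k h)
  · intro J γ k h
    rw [Submodule.mem_comap, phi_mulSym, weight_add_single]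
    exact add_mem (mulExt_mem_weightSpace b k (monomials_mem_weightSpace b _))
      (mulSym_mem_weightSpace b k h)

theorem kappa_monomials_mem (t : Finset ι × (ι →₀ ℕ)) :
    kappa R V (monomials b t) ∈ weightSpace b (weight t) := by
  refine monomials_induction b
    (P := fun J γ => (weightSpace b (weight (J, γ))).comap (kappa R V)) ?_ ?_ ?_ t.1 t.2
  · rw [Submodule.mem_comap, kappa_one]
    exact zero_mem _
  · intro J k hk h
    rw [Submodule.mem_comap, kappa_mulExt, weight_insert hk]
    exact sub_mem (mulSym_mem_weightSpace b k (monomials_mem_weightSpace b _))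
      (mulExt_mem_weightSpace b k h)
  · intro J γ k h
    rw [Submodule.mem_comap, kappa_mulSym, weight_add_single]
    exact mulSym_mem_weightSpace b k h

/-- Cartan's formula: on the multihomogeneous component of degree `α` the Lie derivative along
`x_k ∂/∂x_k` is multiplication by `α_k`. -/
theorem phi_partialHomotopy_add (k : ι) {α : ι →₀ ℕ} {y : Ambient R V}
    (hy : y ∈ weightSpace b α) :
    phi R V (partialHomotopy b k y) + partialHomotopy b k (phi R V y) = α k • y := by
  refine monomialSpan_le b (N := LinearMap.eqLocus
    (phi R V ∘ₗ partialHomotopy b k + partialHomotopy b k ∘ₗ phi R V)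
    (α k • LinearMap.id)) ?_ hy
  rintro t rfl
  refine monomials_induction b (P := fun J γ => LinearMap.eqLocus
    (phi R V ∘ₗ partialHomotopy b k + partialHomotopy b k ∘ₗ phi R V)
    (weight (J, γ) k • LinearMap.id)) ?_ ?_ ?_ t.1 t.2
  · simp [phi_one, partialHomotopy_one, weight]
  · intro J j hj h
    simp only [LinearMap.mem_eqLocus, LinearMap.add_apply, LinearMap.comp_apply,
      LinearMap.smul_apply, LinearMap.id_apply] at h ⊢
    simp only [phi_mulExt, partialHomotopy_mulExt, map_sub, map_smul, map_neg, phi_mulSym,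
      weight_insert hj, Finsupp.add_apply, add_smul]
    rw [← map_nsmul, ← h, map_add]
    rcases eq_or_ne j k with rfl | hjk
    · simp
      abel
    · simp [hjk]
  · intro J γ j h
    simp only [LinearMap.mem_eqLocus, LinearMap.add_apply, LinearMap.comp_apply,
      LinearMap.smul_apply, LinearMap.id_apply] at h ⊢
    simp only [phi_mulSym, partialHomotopy_mulExt, partialHomotopy_mulSym, map_add,
      weight_add_single, Finsupp.add_apply, add_smul]
    rw [← map_nsmul, ← h, map_add]
    rcases eq_or_ne j k with rfl | hjk
    · simp
      abel
    · simp [hjk]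
      abel

section homotopy

variable (p : ℕ)

open Classical in
/-- A homotopy that contracts the component of multidegree `α` if `α` is not divisible by `p`. -/
def weightHomotopy (α : ι →₀ ℕ) : Ambient R V →ₗ[R] Ambient R V :=
  if h : ∃ k, ¬ p ∣ α k then
    Ring.inverse ((α h.choose : ℕ) : R) • partialHomotopy b h.choose
  else 0

/-- A homotopy from the identity to the projection onto the components of the multidegrees that
are divisible by `p`. -/
def homotopy : Ambient R V →ₗ[R] Ambient R V :=
  (monomials b).constr R fun t => weightHomotopy b p (weight t) (monomials b t)

theorem homotopy_eq {α : ι →₀ ℕ} {y : Ambient R V} (hy : y ∈ weightSpace b α) :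
    homotopy b p y = weightHomotopy b p α y := by
  refine monomialSpan_le b (N := LinearMap.eqLocus (homotopy b p) (weightHomotopy b p α)) ?_ hy
  rintro t rfl
  simp [homotopy, Module.Basis.constr_basis]

/-- Since `κ` preserves multidegrees, the same index `k` and the same scalar are selected on both
sides, and `kappa_partialHomotopy` applies. -/
theorem homotopy_kappa (y : Ambient R V) :
    homotopy b p (kappa R V y) = - kappa R V (homotopy b p y) := by
  suffices homotopy b p ∘ₗ kappa R V = - (kappa R V ∘ₗ homotopy b p) from congr($this y)
  refine (monomials b).ext fun t => ?_
  simp only [LinearMap.comp_apply, LinearMap.neg_apply]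
  rw [homotopy_eq b p (kappa_monomials_mem b t), homotopy_eq b p (monomials_mem_weightSpace b t),
    weightHomotopy]
  split_ifs
  · simp only [LinearMap.smul_apply, map_smul, kappa_partialHomotopy, smul_neg, neg_neg]
  · simp

open Classical in
/-- The projection onto the components of the multidegrees that are divisible by `p`. -/
def divProj : Ambient R V →ₗ[R] Ambient R V :=
  (monomials b).constr R fun t => if ∀ k, p ∣ weight t k then monomials b t else 0

theorem homotopy_mem {i : ℕ} {j : ℤ} {y : Ambient R V} (hy : y ∈ piece R V (i + 1) j) :
    homotopy b p y ∈ piece R V i (j + 1) := by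
  refine monomialSpan_le b (N := (piece R V i (j + 1)).comap (homotopy b p)) ?_
    (piece_le_monomialSpan b _ _ hy)
  rintro ⟨J, γ⟩ ⟨h1, h2⟩
  rw [Submodule.mem_comap, homotopy_eq b p (monomials_mem_weightSpace b _), weightHomotopy]
  split_ifs
  · exact Submodule.smul_mem _ _ (partialHomotopy_mem b _ (monomials_mem_piece b h1 h2))
  · exact zero_mem _

variable [Fact p.Prime] [CharP R p]

/-- An integer prime to `p` is already invertible in `ZMod p`, so `R` need not be a field. This
makes `Ring.inverse` in `weightHomotopy` a genuine inverse. -/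
theorem isUnit_natCast_of_not_dvd {n : ℕ} (hn : ¬ p ∣ n) : IsUnit (n : R) := by
  have h : IsUnit (n : ZMod p) := by
    rw [ZMod.isUnit_iff_coprime]
    exact (Nat.Coprime.symm ((Nat.Prime.coprime_iff_not_dvd Fact.out).2 hn))
  simpa using h.map (ZMod.castHom (dvd_refl p) R)

/-- Where `p ∤ α_k` this is Cartan's formula divided by `α_k`; `φ` preserves the multidegree, so
both summands use the same `k`. In multidegrees divisible by `p` the homotopy is zero by definition
and `divProj` is the identity. -/
theorem phi_homotopy_add (y : Ambient R V) :
    phi R V (homotopy b p y) + homotopy b p (phi R V y) = y - divProj b p y := by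
  suffices phi R V ∘ₗ homotopy b p + homotopy b p ∘ₗ phi R V = LinearMap.id - divProj b p from
    congr($this y)
  refine (monomials b).ext fun t => ?_
  simp only [LinearMap.comp_apply, LinearMap.add_apply, LinearMap.sub_apply, LinearMap.id_apply]
  rw [homotopy_eq b p (phi_monomials_mem b t), homotopy_eq b p (monomials_mem_weightSpace b t),
    weightHomotopy, divProj, Module.Basis.constr_basis]
  split_ifs with h1 h2 h2
  · obtain ⟨k, hk⟩ := h1
    exact absurd (h2 k) hk
  · simp only [LinearMap.smul_apply, map_smul, sub_zero]
    rw [← smul_add, phi_partialHomotopy_add b _ (monomials_mem_weightSpace b t),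
      ← Nat.cast_smul_eq_nsmul R, smul_smul,
      Ring.inverse_mul_cancel _ (isUnit_natCast_of_not_dvd p h1.choose_spec), one_smul]
  · simp
  · push Not at h1
    exact absurd h1 h2

end homotopy

end

section

variable {ι : Type v} (b : Module.Basis ι R V)
variable (p : ℕ)

/-! ### Powers of vectors in characteristic `p` -/

/-- Here `d(v ^ p) = p v ^ (p - 1) dv` vanishes. -/
theorem phi_mulSym_pow_char [CharP R p] (v : V) (y : Ambient R V) :
    phi R V ((mulSym R v ^ p) y) = (mulSym R v ^ p) (phi R V y) := by
  rw [phi_mulSym_pow, ← Nat.cast_smul_eq_nsmul R, CharP.cast_eq_zero, zero_smul, add_zero]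

theorem mulSym_add_pow_char [CharP R p] [Fact p.Prime] (v w : V) :
    mulSym R (v + w) ^ p = mulSym R v ^ p + mulSym R w ^ p := by
  obtain ⟨r, hr⟩ := (commute_mulSym (R := R) v w).exists_add_pow_prime_eq (p := p) Fact.out
  rw [mulSym_add, hr, mul_assoc, mul_assoc, ← nsmul_eq_mul, ← Nat.cast_smul_eq_nsmul R,
    CharP.cast_eq_zero, zero_smul, add_zero]

/-- The divided difference `((v + w) ^ p - v ^ p - w ^ p) / p` shows that
`(v + w) ^ (p - 1) d(v + w)` and `v ^ (p - 1) dv + w ^ (p - 1) dw` differ by an exact form. -/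
theorem mulSym_pow_mulExt_add_sub_mem_range [Fact p.Prime] (v w : V) {z : Ambient R V}
    (hz : phi R V z = 0) :
    (mulSym R (v + w) ^ (p - 1)) (mulExt R (v + w) z) -
      ((mulSym R v ^ (p - 1)) (mulExt R v z) + (mulSym R w ^ (p - 1)) (mulExt R w z)) ∈
      LinearMap.range (phi R V) := by
  have hp : p.Prime := Fact.out
  obtain ⟨n, rfl⟩ : ∃ n, p = n + 1 := ⟨p - 1, (Nat.sub_add_cancel hp.pos).symm⟩
  have hdvd : ∀ i ∈ Finset.range n, ∃ a : ℕ, (n + 1).choose (i + 1) = (n + 1) * a := fun i hi =>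
    hp.dvd_choose_self i.succ_ne_zero (by simpa using hi)
  -- With `p = n + 1`, the number `a i` is the binomial coefficient `p.choose (i + 1)` divided by
  -- `p`; `ha1` and `ha2` compute the coefficients that differentiation produces. All of this is
  -- integral, so no characteristic is assumed.
  choose! a ha using hdvd
  have ha1 : ∀ i ∈ Finset.range n, a i * (i + 1) = n.choose i := fun i hi => by
    have h := Nat.add_one_mul_choose_eq n i
    rw [ha i hi, mul_assoc] at h
    exact (Nat.eq_of_mul_eq_mul_left n.succ_pos h).symm
  have ha2 : ∀ i ∈ Finset.range n, a i * (n - i) = n.choose (i + 1) := fun i hi => by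
    have h := Nat.choose_mul_succ_eq n (i + 1)
    rw [ha i hi, mul_comm, mul_assoc, Nat.add_sub_add_right] at h
    exact (Nat.eq_of_mul_eq_mul_left n.succ_pos h).symm
  have hpow : ∀ u : Ambient R V, (mulSym R (v + w) ^ n) u =
      ∑ i ∈ Finset.range (n + 1),
        n.choose i • (mulSym R v ^ i) ((mulSym R w ^ (n - i)) u) := fun u => by
    rw [mulSym_add, (commute_mulSym v w).add_pow, LinearMap.sum_apply]
    refine Finset.sum_congr rfl fun i _ => ?_
    rw [← (Nat.cast_commute _ _).eq, ← nsmul_eq_mul]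
    rfl
  -- The primitive is the divided difference times `z`, with `i + 1` running through the exponents
  -- of `v` from `1` to `p - 1`.
  refine ⟨∑ i ∈ Finset.range n, a i • (mulSym R v ^ (i + 1)) ((mulSym R w ^ (n - i)) z), ?_⟩
  have hterm : ∀ i ∈ Finset.range n,
      phi R V (a i • (mulSym R v ^ (i + 1)) ((mulSym R w ^ (n - i)) z)) =
        n.choose i • (mulSym R v ^ i) ((mulSym R w ^ (n - i)) (mulExt R v z)) +
        n.choose (i + 1) •
          (mulSym R v ^ (i + 1)) ((mulSym R w ^ (n - (i + 1))) (mulExt R w z)) := fun i hi => by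
    rw [map_nsmul, phi_mulSym_pow, phi_mulSym_pow, hz, map_zero, zero_add, map_nsmul,
      mulExt_mulSym_pow, smul_add, smul_smul, smul_smul, ha1 i hi, ha2 i hi,
      Nat.add_sub_cancel, Nat.sub_sub, add_comm]
  -- The two sums are the expansions of `(v + w) ^ n dv` and `(v + w) ^ n dw`, lacking exactly the
  -- end terms `v ^ n dv` and `w ^ n dw`.
  rw [map_sum, Finset.sum_congr rfl hterm, Finset.sum_add_distrib, Nat.add_sub_cancel,
    mulExt_add, LinearMap.add_apply, map_add, hpow (mulExt R v z), hpow (mulExt R w z),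
    Finset.sum_range_succ, Finset.sum_range_succ' _ n]
  simp only [Nat.choose_self, Nat.choose_zero_right, Nat.sub_self, Nat.sub_zero, pow_zero,
    one_smul, Module.End.one_apply]
  abel

/-! ### The inverse Cartier operator -/

/-- The index of the monomial `∏ x_k ^ (p γ_k) ∏_{k ∈ J} x_k ^ (p - 1) dx_k`. -/
def cartierIndex (t : Finset ι × (ι →₀ ℕ)) : Finset ι × (ι →₀ ℕ) :=
  (t.1, p • t.2 + ∑ k ∈ t.1, Finsupp.single k (p - 1))

theorem cartierIndex_add_single (J : Finset ι) (γ : ι →₀ ℕ) (k : ι) :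
    cartierIndex p (J, γ + Finsupp.single k 1) =
      (J, (cartierIndex p (J, γ)).2 + Finsupp.single k p) := by
  simp only [cartierIndex, smul_add, Finsupp.smul_single, smul_eq_mul, mul_one]
  congr 1
  abel

theorem degree_cartierIndex (t : Finset ι × (ι →₀ ℕ)) :
    (cartierIndex p t).2.degree = p * t.2.degree + t.1.card * (p - 1) := by
  simp [cartierIndex, map_sum, -Finsupp.single_tsub]

variable [LinearOrder ι]

theorem cartierIndex_insert {k : ι} {J : Finset ι} (hk : k ∉ J) (γ : ι →₀ ℕ) :
    cartierIndex p (insert k J, γ) =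
      (insert k J, (cartierIndex p (J, γ)).2 + Finsupp.single k (p - 1)) := by
  simp only [cartierIndex]
  rw [Finset.sum_insert hk]
  congr 1
  abel

theorem cartierIndex_snd_apply (J : Finset ι) (γ : ι →₀ ℕ) (k : ι) :
    (cartierIndex p (J, γ)).2 k = p * γ k + if k ∈ J then p - 1 else 0 := by
  simp [cartierIndex, Finsupp.single_apply, -Finsupp.single_tsub]

theorem cartierIndex_injective [Fact p.Prime] :
    Function.Injective (cartierIndex p : Finset ι × (ι →₀ ℕ) → _) := by
  rintro ⟨J, γ⟩ ⟨J', γ'⟩ h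
  obtain rfl : J = J' := congrArg Prod.fst h
  congr 1
  ext k
  have h' := congr($(congrArg Prod.snd h) k)
  rw [cartierIndex_snd_apply, cartierIndex_snd_apply] at h'
  exact Nat.eq_of_mul_eq_mul_left (Nat.Prime.pos Fact.out) (Nat.add_right_cancel h')

theorem weight_cartierIndex [Fact p.Prime] (t : Finset ι × (ι →₀ ℕ)) :
    weight (cartierIndex p t) = p • weight t := by
  have hp := Nat.Prime.pos (p := p) Fact.out
  ext k
  rw [← Prod.mk.eta (p := cartierIndex p t), weight_apply, ← Prod.mk.eta (p := t),
    cartierIndex_snd_apply, Finsupp.smul_apply, weight_apply]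
  rw [show (cartierIndex p t).1 = t.1 from rfl, smul_eq_mul, mul_add]
  by_cases h : k ∈ t.1
  · simp only [if_pos h]
    omega
  · simp only [if_neg h, mul_zero, add_zero]

/-- The preimage keeps the exterior part `J`: divide the multidegree by `p`, then remove the
contribution of `J`. -/
theorem exists_cartierIndex_eq [Fact p.Prime] {t : Finset ι × (ι →₀ ℕ)}
    (ht : ∀ k, p ∣ weight t k) : ∃ t', cartierIndex p t' = t := by
  have hp := Nat.Prime.pos (p := p) Fact.out
  obtain ⟨J, γ⟩ := t
  refine ⟨(J, (weight (J, γ)).mapRange (· / p) (Nat.zero_div p) -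
    ∑ k ∈ J, Finsupp.single k 1), ?_⟩
  refine Prod.ext rfl (Finsupp.ext fun k => ?_)
  obtain ⟨q, hq⟩ := ht k
  rw [cartierIndex_snd_apply, Finsupp.tsub_apply, Finsupp.mapRange_apply, hq,
    Nat.mul_div_cancel_left _ hp]
  rw [weight_apply] at hq
  simp only [Finsupp.coe_finsetSum, Finset.sum_apply, Finsupp.single_apply, Finset.sum_ite_eq']
  split_ifs with h
  · rw [if_pos h] at hq
    -- For `k ∈ J` one has `p q = γ k + 1 > 0`, so `q` is positive and the truncated subtraction is
    -- exact.
    obtain ⟨q, rfl⟩ : ∃ q', q = q' + 1 := ⟨q - 1, by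
      rcases q with _ | q
      · omega
      · simp⟩
    rw [mul_add] at hq
    simp only [Nat.add_sub_cancel]
    omega
  · rw [if_neg h] at hq
    simp only [tsub_zero]
    omega

section frobenius

variable [ExpChar R p]

/-- The inverse Cartier operator in the coordinates given by a basis of `V`: the Frobenius
semilinear map with `x_k ↦ x_k ^ p` and `dx_k ↦ x_k ^ (p - 1) dx_k`. -/
def cartier : Ambient R V →ₛₗ[frobenius R p] Ambient R V where
  toFun y := ((monomials b).repr y).sum fun t r => r ^ p • monomials b (cartierIndex p t)
  map_add' y z := by
    rw [map_add]
    refine Finsupp.sum_add_index' (fun t => ?_) fun t r s => ?_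
    · rw [← frobenius_def, map_zero, zero_smul]
    · rw [← frobenius_def, map_add, add_smul]; rfl
  map_smul' r y := by
    change ((monomials b).repr (r • y)).sum _ = (r ^ p) • ((monomials b).repr y).sum _
    rw [map_smul, Finsupp.sum_smul_index', Finsupp.smul_sum]
    · refine Finset.sum_congr rfl fun t _ => ?_
      simp only [smul_eq_mul, mul_pow, mul_smul]
    · intro t
      rw [← frobenius_def, map_zero, zero_smul]

theorem cartier_monomials (t : Finset ι × (ι →₀ ℕ)) :
    cartier b p (monomials b t) = monomials b (cartierIndex p t) := by
  have h : cartier b p (monomials b t) = ((monomials b).repr (monomials b t)).sum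
    fun t r => r ^ p • monomials b (cartierIndex p t) := rfl
  rw [h, Module.Basis.repr_self, Finsupp.sum_single_index, one_pow, one_smul]
  rw [← frobenius_def, map_zero, zero_smul]

theorem cartier_one : cartier b p (tmul R V 1 1) = tmul R V 1 1 := by
  rw [← monomials_zero b, cartier_monomials]
  simp [cartierIndex]

theorem cartier_mulSym_basis (k : ι) (y : Ambient R V) :
    cartier b p (mulSym R (b k) y) = (mulSym R (b k) ^ p) (cartier b p y) := by
  suffices (cartier b p).comp (mulSym R (b k)) = (mulSym R (b k) ^ p).comp (cartier b p) from
    congr($this y)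
  refine (monomials b).ext fun ⟨J, γ⟩ => ?_
  simp only [LinearMap.comp_apply]
  rw [mulSym_monomials, cartier_monomials, cartier_monomials, cartierIndex_add_single,
    ← mulSym_pow_monomials]
  rfl

theorem cartier_mulExt_basis (k : ι) (y : Ambient R V) :
    cartier b p (mulExt R (b k) y) =
      (mulSym R (b k) ^ (p - 1)) (mulExt R (b k) (cartier b p y)) := by
  suffices (cartier b p).comp (mulExt R (b k)) =
      ((mulSym R (b k) ^ (p - 1) : Module.End R (Ambient R V)) ∘ₗ mulExt R (b k)).comp
        (cartier b p) from congr($this y)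
  refine (monomials b).ext fun ⟨J, γ⟩ => ?_
  simp only [LinearMap.comp_apply]
  rw [cartier_monomials]
  by_cases hk : k ∈ J
  · rw [mulExt_monomials_of_mem b hk, cartierIndex, mulExt_monomials_of_mem b hk, map_zero,
      map_zero]
  · obtain ⟨ε, -, hε⟩ := exists_mulExt_monomials b hk
    rw [hε, map_zsmul, cartier_monomials, cartierIndex_insert p hk,
      show cartierIndex p (J, γ) = (J, (cartierIndex p (J, γ)).2) from rfl, hε, map_zsmul,
      mulSym_pow_monomials]

/-- The relation `hj` says that the total degree is multiplied by `p` while the exterior degree `i`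
is unchanged. -/
theorem cartier_mem {i : ℕ} {j j' : ℤ} (hp : 0 < p) (hj : j' + i = p * (j + i)) {y : Ambient R V}
    (hy : y ∈ piece R V i j) : cartier b p y ∈ piece R V i j' := by
  refine monomialSpan_le b (N := (piece R V i j').comap (cartier b p)) ?_
    (piece_le_monomialSpan b _ _ hy)
  rintro t ⟨rfl, rfl⟩
  rw [Submodule.mem_comap, cartier_monomials]
  refine monomials_mem_piece b (J := t.1) (γ := (cartierIndex p t).2) rfl ?_
  rw [degree_cartierIndex]
  push_cast [Nat.cast_sub (show 1 ≤ p from hp)]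
  linear_combination -hj

/-- The point is `κ (x_k ^ (p - 1) dx_k) = x_k ^ (p - 1) x_k = x_k ^ p`, the image of `x_k = κ
(dx_k)`. -/
theorem cartier_kappa [Fact p.Prime] (y : Ambient R V) :
    cartier b p (kappa R V y) = kappa R V (cartier b p y) := by
  have hp := Nat.Prime.pos (p := p) Fact.out
  suffices h : LinearMap.eqLocus ((cartier b p).comp (kappa R V))
      ((kappa R V).comp (cartier b p)) = ⊤ from
    LinearMap.mem_eqLocus.1 (h.ge (Submodule.mem_top (x := y)))
  refine eq_top_of_mulExt_of_mulSym b ?_ ?_ ?_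
  · simp [kappa_one, cartier_one]
  · intro k y hy
    simp only [LinearMap.mem_eqLocus, LinearMap.comp_apply] at hy ⊢
    rw [kappa_mulExt, map_sub, cartier_mulSym_basis, cartier_mulExt_basis, cartier_mulExt_basis,
      hy, kappa_mulSym_pow, kappa_mulExt, map_sub]
    congr 1
    rw [← Module.End.mul_apply, ← pow_succ, Nat.sub_add_cancel hp]
  · intro k y hy
    simp only [LinearMap.mem_eqLocus, LinearMap.comp_apply] at hy ⊢
    rw [kappa_mulSym, cartier_mulSym_basis, cartier_mulSym_basis, kappa_mulSym_pow, hy]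

variable [CharP R p]

/-- Values of the operator are built from the closed forms `x_k ^ p` and `x_k ^ (p - 1) dx_k`. -/
theorem phi_cartier (y : Ambient R V) : phi R V (cartier b p y) = 0 := by
  suffices h : LinearMap.ker ((phi R V).comp (cartier b p)) = ⊤ from
    LinearMap.mem_ker.1 (h.ge (Submodule.mem_top (x := y)))
  refine eq_top_of_mulExt_of_mulSym b ?_ ?_ ?_
  · simp [phi_one, cartier_one]
  · intro k y hy
    simp only [LinearMap.mem_ker, LinearMap.comp_apply] at hy ⊢
    rw [cartier_mulExt_basis, phi_mulSym_pow_mulExt, hy, map_zero, map_zero, neg_zero]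
  · intro k y hy
    simp only [LinearMap.mem_ker, LinearMap.comp_apply] at hy ⊢
    rw [cartier_mulSym_basis, phi_mulSym_pow_char, hy, map_zero]

variable [Fact p.Prime]

theorem phi_monomials_of_dvd {t : Finset ι × (ι →₀ ℕ)} (ht : ∀ k, p ∣ weight t k) :
    phi R V (monomials b t) = 0 := by
  obtain ⟨t', rfl⟩ := exists_cartierIndex_eq p ht
  rw [← cartier_monomials, phi_cartier]

/-! ### Independence of the basis -/

/-- The rule extends from basis vectors to all vectors without error, because `v ↦ v ^ p` is
additive and Frobenius semilinear. -/
theorem cartier_mulSym (v : V) (y : Ambient R V) :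
    cartier b p (mulSym R v y) = (mulSym R v ^ p) (cartier b p y) := by
  have hp := Nat.Prime.pos (p := p) Fact.out
  induction b.mem_span v using Submodule.span_induction with
  | zero =>
    rw [← zero_smul R (0 : V), mulSym_smul, zero_smul, zero_pow hp.ne']
    simp
  | mem v hv => obtain ⟨k, rfl⟩ := hv; exact cartier_mulSym_basis b p k y
  | add v w _ _ hv hw =>
    rw [mulSym_add_pow_char, mulSym_add, LinearMap.add_apply, map_add, hv, hw, LinearMap.add_apply]
  | smul r v _ hv =>
    rw [mulSym_smul, LinearMap.smul_apply, map_smulₛₗ, hv, smul_pow]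
    rfl

/-- In contrast to `v ^ p`, the form `v ^ (p - 1) dv` is additive in `v` only up to exact forms, and
the values of `cartier` are closed, as the divided difference argument requires. Scalars cause no
error, as `r ^ (p - 1) r = r ^ p`. -/
theorem cartier_mulExt_sub_mem_range (v : V) (y : Ambient R V) :
    cartier b p (mulExt R v y) - (mulSym R v ^ (p - 1)) (mulExt R v (cartier b p y)) ∈
      LinearMap.range (phi R V) := by
  have hp := Nat.Prime.pos (p := p) Fact.out
  induction b.mem_span v using Submodule.span_induction with
  | zero =>
    rw [← zero_smul R (0 : V), mulExt_smul, zero_smul]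
    simp
  | mem v hv => obtain ⟨k, rfl⟩ := hv; rw [cartier_mulExt_basis, sub_self]; exact zero_mem _
  | add v w _ _ hv hw =>
    have h := sub_mem (add_mem hv hw)
      (mulSym_pow_mulExt_add_sub_mem_range p v w (phi_cartier b p y))
    convert h using 1
    rw [mulExt_add v w, LinearMap.add_apply, map_add]
    abel
  | smul r v _ hv =>
    have h := Submodule.smul_mem _ (r ^ p) hv
    convert h using 1
    rw [mulSym_smul, mulExt_smul, LinearMap.smul_apply, LinearMap.smul_apply, map_smulₛₗ,
      smul_pow, LinearMap.smul_apply, map_smul, smul_smul, pow_sub_one_mul hp.ne', smul_sub]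
    rfl

/-- The error stays exact as factors are added, because `φ` commutes with multiplication by `v ^ p`
and anticommutes with multiplication by `v ^ (p - 1) dv`. -/
theorem cartier_ambientRep_sub_mem_range (g : LinearMap.GeneralLinearGroup R V)
    (y : Ambient R V) :
    cartier b p (ambientRep R V g y) - ambientRep R V g (cartier b p y) ∈
      LinearMap.range (phi R V) := by
  suffices h : (LinearMap.range (phi R V)).comap ((cartier b p).comp (ambientRep R V g) -
      (ambientRep R V g).comp (cartier b p)) = ⊤ from
    (h.ge (Submodule.mem_top (x := y)))
  refine eq_top_of_mulExt_of_mulSym b ?_ ?_ ?_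
  · simp [ambientRep_one_tmul, cartier_one]
  · intro k y hy
    simp only [Submodule.mem_comap, LinearMap.sub_apply, LinearMap.comp_apply] at hy ⊢
    obtain ⟨u, hu⟩ := hy
    rw [cartier_mulExt_basis, ambientRep_mulExt, ambientRep_mulSym_pow, ambientRep_mulExt]
    have h := cartier_mulExt_sub_mem_range b p ((g : V →ₗ[R] V) (b k)) (ambientRep R V g y)
    -- The difference splits into the error of `cartier` for the new factor `g x_k` and the product
    -- of `(g x_k) ^ (p - 1) d(g x_k)` with the inductive error.
    refine (sub_add_sub_cancel _ _ _).subst (motive := (· ∈ LinearMap.range (phi R V)))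
      (add_mem h ?_)
    rw [← map_sub, ← map_sub, ← hu, ← neg_neg ((_ : Module.End R _) _), ← phi_mulSym_pow_mulExt]
    exact neg_mem ⟨_, rfl⟩
  · intro k y hy
    simp only [Submodule.mem_comap, LinearMap.sub_apply, LinearMap.comp_apply] at hy ⊢
    obtain ⟨u, hu⟩ := hy
    rw [cartier_mulSym_basis, ambientRep_mulSym, cartier_mulSym, ambientRep_mulSym_pow,
      ← map_sub, ← hu, ← phi_mulSym_pow_char]
    exact ⟨_, rfl⟩

end frobenius

end

/-! ### Exact forms of degree one -/

theorem kappa_of_mem_piece_zero {j : ℤ} {y : Ambient R V} (hy : y ∈ piece R V 0 j) :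
    kappa R V y = 0 := by
  -- The induction runs over all bidegrees, so the motive is made trivial in positive exterior
  -- degree.
  refine piece_induction (P := fun i _ => match i with
    | 0 => LinearMap.ker (kappa R V)
    | _ + 1 => ⊤) kappa_one (fun _ _ _ _ => Submodule.mem_top) ?_ 0 j hy
  rintro (_ | i) n v y hy
  · change kappa R V _ = 0
    rw [kappa_mulSym, LinearMap.mem_ker.1 hy, map_zero]
  · exact Submodule.mem_top

/-- Modulo the image of `κ`, one has `v ds = n s dv` for `s` of degree `n`. -/
theorem mulSym_phi_sub_mem {n : ℕ} {y : Ambient R V} (hy : y ∈ piece R V 0 n) (v : V) :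
    mulSym R v (phi R V y) - n • mulExt R v y ∈ (piece R V 2 (n - 1)).map (kappa R V) := by
  let P : ℕ → ℤ → Submodule R (Ambient R V) := fun i j => match i with
    | 0 => piece R V 0 j ⊓ ⨅ v : V, ((piece R V 2 (j - 1)).map (kappa R V)).comap
      (mulSym R v ∘ₗ phi R V - j • mulExt R v)
    | _ + 1 => ⊤
  have h : piece R V 0 n ≤ P 0 n := by
    refine piece_induction ?_ (fun _ _ _ _ => Submodule.mem_top) ?_ 0 n
    · refine Submodule.mem_inf.2 ⟨one_mem, (Submodule.mem_iInf _).2 fun v => ?_⟩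
      simp [phi_one]
    · rintro (_ | i) n w y hy
      · obtain ⟨hy, h⟩ := Submodule.mem_inf.1 hy
        have e : ((n + 1 : ℕ) : ℤ) = n + 1 := by push_cast; ring
        rw [e]
        refine Submodule.mem_inf.2 ⟨mulSym_mem w hy, (Submodule.mem_iInf _).2 fun v => ?_⟩
        obtain ⟨u, hu, hu'⟩ := (Submodule.mem_iInf _).1 h v
        rw [Submodule.mem_comap, add_sub_cancel_right]
        -- For a function `y`, `κ (y dw ∧ dv) = v y dw - w y dv`; these are the terms by which the
        -- claim for `w y` differs from `w` times the claim for `y`.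
        refine ⟨mulSym R w u + mulExt R v (mulExt R w y), add_mem ?_ ?_, ?_⟩
        · have := mulSym_mem w hu
          rwa [sub_add_cancel] at this
        · exact mulExt_mem v (mulExt_mem w hy)
        · simp only [LinearMap.sub_apply, LinearMap.comp_apply, LinearMap.smul_apply] at hu' ⊢
          rw [map_add, kappa_mulSym, hu', kappa_mulExt, kappa_mulExt,
            kappa_of_mem_piece_zero hy, phi_mulSym]
          simp only [map_sub, map_add, map_zero, sub_zero, mulExt_mulSym, map_zsmul, add_smul,
            one_smul]
          rw [mulSym_mulSym v w]
          abel
      · exact Submodule.mem_top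
  have := (Submodule.mem_iInf _).1 (Submodule.mem_inf.1 (h hy)).2 v
  simpa using this

/-- Modulo `κ`, `d(w s) = s dw + w ds` equals `(n + 1) s dw` for `s` of degree `n`, and `n + 1 = m`
is zero in `R`. -/
theorem phi_mem_map_kappa {m : ℕ} (hm : (m : R) = 0) {y : Ambient R V}
    (hy : y ∈ piece R V 0 m) : phi R V y ∈ (piece R V 2 (m - 2)).map (kappa R V) := by
  -- The vanishing of the degree in `R` is a premise inside the motive, since it generally fails in
  -- lower degrees; the inductive step uses only the membership of `y`.
  let P : ℕ → ℤ → Submodule R (Ambient R V) := fun i j => match i with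
    | 0 => piece R V 0 j ⊓ ⨅ _ : (j : R) = 0,
        ((piece R V 2 (j - 2)).map (kappa R V)).comap (phi R V)
    | _ + 1 => ⊤
  have h : piece R V 0 m ≤ P 0 m := by
    refine piece_induction ?_ (fun _ _ _ _ => Submodule.mem_top) ?_ 0 m
    · refine Submodule.mem_inf.2 ⟨one_mem, (Submodule.mem_iInf _).2 fun _ => ?_⟩
      simp [phi_one]
    · rintro (_ | i) n w y hy
      · obtain ⟨hy, -⟩ := Submodule.mem_inf.1 hy
        refine Submodule.mem_inf.2 ⟨by exact_mod_cast mulSym_mem w hy,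
          (Submodule.mem_iInf _).2 fun h0 => ?_⟩
        have h1 := mulSym_phi_sub_mem hy w
        rw [Submodule.mem_comap, phi_mulSym,
          show ((n + 1 : ℕ) : ℤ) - 2 = n - 1 by push_cast; ring]
        have h2 : mulExt R w y + n • mulExt R w y = 0 := by
          rw [add_comm, ← succ_nsmul, ← Nat.cast_smul_eq_nsmul R]
          rw [Int.cast_natCast] at h0
          rw [h0, zero_smul]
        convert h1 using 1
        rw [add_comm, eq_sub_iff_add_eq, add_assoc, h2, add_zero]
      · exact Submodule.mem_top
  exact (Submodule.mem_iInf _).1 (Submodule.mem_inf.1 (h hy)).2 (by simpa using hm)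

/-! ### Frobenius twists -/

section twist

variable (p : ℕ) [ExpChar R p] {W : Type*} [AddCommGroup W] [Module R W]

/-- The canonical semilinear map `W → FᵖW`. -/
def FrobTwist.ofₛₗ : W →ₛₗ[frobenius R p] FrobTwist R p W where
  toFun := FrobTwist.of p
  map_add' _ _ := TensorProduct.tmul_add _ _ _
  map_smul' r y := FrobTwist.of_smul p r y

theorem FrobTwist.eq_top_of_of_mem {N : Submodule R (FrobTwist R p W)}
    (h : ∀ y : W, FrobTwist.of p y ∈ N) : N = ⊤ := by
  refine eq_top_iff.2 fun x _ => ?_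
  change FrobRing R p ⊗[R] W at x
  induction x using TensorProduct.induction_on with
  | zero => exact N.zero_mem
  | add x y hx hy => exact N.add_mem (hx trivial) (hy trivial)
  | tmul r y =>
    have e : r ⊗ₜ[R] y = r • ((1 : FrobRing R p) ⊗ₜ[R] y) := by
      rw [TensorProduct.smul_tmul', smul_eq_mul, mul_one]
    rw [e]
    exact N.smul_mem (r : R) (h y)

theorem frobTwistRep_of {G : Type*} [Monoid G] (ρ : Representation R G W) (g : G) (y : W) :
    frobTwistRep p ρ g (FrobTwist.of p y) = FrobTwist.of p (ρ g y) := rfl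

variable {p} {H : Type*} [AddCommGroup H] [Module R H]

/-- The additive map underlying `FrobTwist.lift`. -/
def FrobTwist.liftAddHom (f : W →ₛₗ[frobenius R p] H) : FrobRing R p ⊗[R] W →+ H :=
  TensorProduct.liftAddHom
    ({ toFun := fun s =>
        { toFun := fun y => (show R from s) • f y
          map_zero' := by rw [map_zero, smul_zero]
          map_add' := fun y z => by rw [map_add, smul_add] }
       map_zero' := by ext y; exact zero_smul R _
       map_add' := fun s t => by ext y; exact add_smul (show R from s) (show R from t) _ } :
      FrobRing R p →+ W →+ H)
    (fun r s y => by
      change (show R from r • s) • f y = (show R from s) • f (r • y)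
      rw [map_smulₛₗ, smul_smul, mul_comm]
      rfl)

theorem FrobTwist.liftAddHom_smul (f : W →ₛₗ[frobenius R p] H) (r : FrobRing R p)
    (x : FrobRing R p ⊗[R] W) :
    FrobTwist.liftAddHom f (r • x) = (show R from r) • FrobTwist.liftAddHom f x := by
  induction x using TensorProduct.induction_on with
  | zero => rw [smul_zero, map_zero, smul_zero]
  | add x y hx hy => rw [smul_add, map_add, map_add, hx, hy, smul_add]
  | tmul s y =>
    rw [TensorProduct.smul_tmul']
    exact mul_smul (show R from r) (show R from s) (f y)

/-- Frobenius semilinear maps out of `W` are linear maps out of `FᵖW`. -/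
def FrobTwist.lift (f : W →ₛₗ[frobenius R p] H) : FrobTwist R p W →ₗ[R] H where
  __ := FrobTwist.liftAddHom f
  map_smul' r x := FrobTwist.liftAddHom_smul f r x

theorem FrobTwist.lift_of (f : W →ₛₗ[frobenius R p] H) (y : W) :
    FrobTwist.lift f (FrobTwist.of p y) = f y := one_smul R _

end twist

/-! ### A left inverse of the inverse Cartier operator -/

section retraction

variable {ι : Type v} [LinearOrder ι] (b : Module.Basis ι R V)

open Classical in
/-- The projection of `⋀ V ⊗ S(V)` onto a bihomogeneous component. -/
def pieceProj (i : ℕ) (j : ℤ) : Ambient R V →ₗ[R] piece R V i j :=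
  (monomials b).constr R fun t =>
    if h : monomials b t ∈ piece R V i j then ⟨monomials b t, h⟩ else 0

theorem pieceProj_coe {i : ℕ} {j : ℤ} (y : piece R V i j) : pieceProj b i j y = y := by
  refine Subtype.ext ?_
  refine monomialSpan_le b (N := LinearMap.eqLocus
    ((piece R V i j).subtype ∘ₗ pieceProj b i j) LinearMap.id) ?_
    (piece_le_monomialSpan b i j y.2)
  rintro t ⟨hi, hj⟩
  have h : monomials b t ∈ piece R V i j := monomials_mem_piece b hi hj
  simp [pieceProj, Module.Basis.constr_basis, h]

variable (p : ℕ)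

theorem divProj_of_mem_weightSpace {α : ι →₀ ℕ} (hα : ¬ ∀ k, p ∣ α k) {y : Ambient R V}
    (hy : y ∈ weightSpace b α) : divProj b p y = 0 := by
  refine monomialSpan_le b (N := LinearMap.ker (divProj b p)) ?_ hy
  rintro t rfl
  rw [LinearMap.mem_ker, divProj, Module.Basis.constr_basis, if_neg hα]

/-- In multidegrees divisible by `p` the map `φ` is zero, and from any other multidegree its values
stay where `divProj` is zero. -/
theorem divProj_phi [Fact p.Prime] [CharP R p] (y : Ambient R V) : divProj b p (phi R V y) = 0 := by
  suffices divProj b p ∘ₗ phi R V = 0 from congr($this y)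
  refine (monomials b).ext fun t => ?_
  rw [LinearMap.comp_apply, LinearMap.zero_apply]
  by_cases ht : ∀ k, p ∣ weight t k
  · rw [phi_monomials_of_dvd b p ht, map_zero]
  · exact divProj_of_mem_weightSpace b p ht (phi_monomials_mem b t)

variable [ExpChar R p] {W : Type*} [AddCommGroup W] [Module R W]

open Classical in
/-- The linear extension of a map `Q` on `⋀ V ⊗ S(V)` along the inverse Cartier operator. -/
def cartierRetract (Q : Ambient R V →ₗ[R] W) : Ambient R V →ₗ[R] FrobTwist R p W :=
  (monomials b).constr R fun t =>
    if h : ∃ t', cartierIndex p t' = t then FrobTwist.of p (Q (monomials b h.choose)) else 0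

variable [Fact p.Prime] (Q : Ambient R V →ₗ[R] W)

theorem cartierRetract_cartier (y : Ambient R V) :
    cartierRetract b p Q (cartier b p y) = FrobTwist.of p (Q y) := by
  suffices (cartierRetract b p Q).comp (cartier b p) = (FrobTwist.ofₛₗ p).comp Q from
    congr($this y)
  refine (monomials b).ext fun t => ?_
  have h : ∃ t', cartierIndex p t' = cartierIndex p t := ⟨t, rfl⟩
  simp only [LinearMap.comp_apply]
  rw [cartier_monomials, cartierRetract, Module.Basis.constr_basis, dif_pos h,
    cartierIndex_injective p h.choose_spec]
  rfl

theorem cartierRetract_of_mem_weightSpace {α : ι →₀ ℕ} (hα : ¬ ∀ k, p ∣ α k) {y : Ambient R V}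
    (hy : y ∈ weightSpace b α) : cartierRetract b p Q y = 0 := by
  refine monomialSpan_le b (N := LinearMap.ker (cartierRetract b p Q)) ?_ hy
  rintro t rfl
  rw [LinearMap.mem_ker, cartierRetract, Module.Basis.constr_basis, dif_neg]
  rintro ⟨t', rfl⟩
  refine hα fun k => ?_
  rw [weight_cartierIndex]
  exact Dvd.intro _ rfl

/-- In multidegrees divisible by `p` the monomial is a value of `cartier` on a monomial of bidegree
`(i, j)`, by the degree relation `hj`. As `cartier` commutes with `κ`, the retraction returns the
value of `Q` on the image of `κ`. -/
theorem cartierRetract_kappa {i : ℕ} {j j' : ℤ} (hj : j' + i = p * (j + i))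
    (hQ : ∀ y ∈ piece R V i j, Q (kappa R V y) = 0) {y : Ambient R V}
    (hy : y ∈ piece R V i j') : cartierRetract b p Q (kappa R V y) = 0 := by
  have hp := Nat.Prime.pos (p := p) Fact.out
  refine monomialSpan_le b (N := LinearMap.ker (cartierRetract b p Q ∘ₗ kappa R V)) ?_
    (piece_le_monomialSpan b _ _ hy)
  rintro t ⟨h1, h2⟩
  rw [LinearMap.mem_ker, LinearMap.comp_apply]
  by_cases ht : ∀ k, p ∣ weight t k
  · obtain ⟨t', rfl⟩ := exists_cartierIndex_eq p ht
    have h3 : t'.1.card = i := h1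
    rw [degree_cartierIndex, h3] at h2
    have h4 : (t'.2.degree : ℤ) = j := by
      push_cast [Nat.cast_sub (show 1 ≤ p from hp)] at h2
      have h5 : (p : ℤ) * t'.2.degree = p * j := by linear_combination h2 + hj
      exact mul_left_cancel₀ (by exact_mod_cast hp.ne') h5
    rw [← cartier_monomials, ← cartier_kappa, cartierRetract_cartier,
      hQ _ (monomials_mem_piece b h3 h4)]
    exact (FrobTwist.ofₛₗ p).map_zero
  · exact cartierRetract_of_mem_weightSpace b p Q ht (kappa_monomials_mem b t)

variable [CharP R p]

theorem cartierRetract_phi (y : Ambient R V) : cartierRetract b p Q (phi R V y) = 0 := by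
  suffices cartierRetract b p Q ∘ₗ phi R V = 0 from congr($this y)
  refine (monomials b).ext fun t => ?_
  rw [LinearMap.comp_apply, LinearMap.zero_apply]
  by_cases ht : ∀ k, p ∣ weight t k
  · rw [phi_monomials_of_dvd b p ht, map_zero]
  · exact cartierRetract_of_mem_weightSpace b p Q ht (phi_monomials_mem b t)

end retraction

/-! ### Classes of closed forms -/

section classes

variable (m : ℕ) (hm : (m : R) = 0) (i : ℕ)

/-- The class in the `i`-th term of the complex `N_m(V)`. -/
def termMk : piece R V (i + 1) ((m : ℤ) - i - 1) →ₗ[R] Term R V m i :=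
  (hookRel R V ((m : ℤ) - i) i).mkQ

variable {m i}

theorem termMk_eq_zero {y : piece R V (i + 1) ((m : ℤ) - i - 1)} :
    termMk m i y = 0 ↔ ∃ u ∈ piece R V (i + 2) ((m : ℤ) - i - 2), kappa R V u = y :=
  Submodule.Quotient.mk_eq_zero _

theorem diff_termMk (y : piece R V (i + 1) ((m : ℤ) - i - 1)) :
    ∃ h, diff R V m hm i (termMk m i y) = termMk m (i + 1) ⟨phi R V y, h⟩ :=
  ⟨_, rfl⟩

/-- For `i > 0` the form `u` represents an element of the preceding term. For `i = 0` it is a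
function, outside the complex, and its differential is already zero modulo `κ`. -/
theorem termMk_phi_mem_coboundaries {u : Ambient R V} (hu : u ∈ piece R V i ((m : ℤ) - i))
    (h : phi R V u ∈ piece R V (i + 1) ((m : ℤ) - i - 1)) :
    termMk m i ⟨phi R V u, h⟩ ∈ coboundaries R V m hm i := by
  cases i with
  | zero =>
    refine (Submodule.mem_bot R).2 (termMk_eq_zero.2 ?_)
    have := phi_mem_map_kappa hm (y := u) (by simpa using hu)
    simpa using this
  | succ i =>
    have hu' : u ∈ piece R V (i + 1) ((m : ℤ) - i - 1) := by
      rwa [show (m : ℤ) - i - 1 = (m : ℤ) - (i + 1 : ℕ) by push_cast; ring]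
    exact ⟨termMk m i ⟨u, hu'⟩, rfl⟩

theorem termMk_mem_coboundaries {z u u' : Ambient R V}
    (hz : z ∈ piece R V (i + 1) ((m : ℤ) - i - 1)) (hu : u ∈ piece R V i ((m : ℤ) - i))
    (hu' : u' ∈ piece R V (i + 2) ((m : ℤ) - i - 2)) (h : z = phi R V u + kappa R V u') :
    termMk m i ⟨z, hz⟩ ∈ coboundaries R V m hm i := by
  have h1 := phi_mem hu
  have h2 : z - phi R V u ∈ piece R V (i + 1) ((m : ℤ) - i - 1) := sub_mem hz h1
  have h3 : termMk m i ⟨z - phi R V u, h2⟩ = 0 :=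
    termMk_eq_zero.2 ⟨u', hu', eq_sub_of_add_eq' h.symm⟩
  have h4 : (⟨z, hz⟩ : piece R V (i + 1) ((m : ℤ) - i - 1)) =
      ⟨phi R V u, h1⟩ + ⟨z - phi R V u, h2⟩ := Subtype.ext (add_sub_cancel _ _).symm
  rw [h4, map_add, h3, add_zero]
  exact termMk_phi_mem_coboundaries hm hu h1

/-- The bidegree of `u` is not recorded, because `cartierRetract_phi` holds for all forms. -/
theorem exists_of_termMk_mem_coboundaries {z : Ambient R V}
    {hz : z ∈ piece R V (i + 1) ((m : ℤ) - i - 1)}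
    (h : termMk m i ⟨z, hz⟩ ∈ coboundaries R V m hm i) :
    ∃ u, ∃ u' ∈ piece R V (i + 2) ((m : ℤ) - i - 2), z = phi R V u + kappa R V u' := by
  cases i with
  | zero =>
    obtain ⟨u', hu', h'⟩ := termMk_eq_zero.1 ((Submodule.mem_bot R).1 h)
    exact ⟨0, u', hu', by rw [map_zero, zero_add, h']⟩
  | succ i =>
    obtain ⟨x, hx⟩ := h
    obtain ⟨y, rfl⟩ := Submodule.Quotient.mk_surjective _ x
    obtain ⟨hy, e⟩ := diff_termMk hm y
    have h0 : termMk m (i + 1) (⟨z, hz⟩ - ⟨phi R V y, hy⟩) = 0 := by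
      rw [map_sub, ← hx, ← e]
      exact sub_self _
    obtain ⟨u', hu', h'⟩ := termMk_eq_zero.1 h0
    exact ⟨y, u', hu', by rw [h']; simp⟩

variable (R V m i) in
/-- The closed forms in `⋀ⁱ⁺¹ V ⊗ Sₘ₋ᵢ₋₁(V)`. -/
def closedForms : Submodule R (Ambient R V) :=
  piece R V (i + 1) ((m : ℤ) - i - 1) ⊓ LinearMap.ker (phi R V)

/-- The cohomology class of a closed form. -/
def closedClass : closedForms R V m i →ₗ[R] Cohomology R V m hm i :=
  Submodule.mkQ _ ∘ₗ (termMk m i ∘ₗ Submodule.inclusion inf_le_left).codRestrict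
    (cocycles R V m hm i) fun z => by
      obtain ⟨h, e⟩ := diff_termMk hm (Submodule.inclusion inf_le_left z)
      refine LinearMap.mem_ker.2 (e.trans ((congrArg _ (Subtype.ext ?_)).trans (map_zero _)))
      exact LinearMap.mem_ker.1 z.2.2

theorem closedClass_eq_zero {z : closedForms R V m i} :
    closedClass hm z = 0 ↔ termMk m i ⟨z, z.2.1⟩ ∈ coboundaries R V m hm i :=
  Submodule.Quotient.mk_eq_zero _

theorem closedClass_ambientRep (g : LinearMap.GeneralLinearGroup R V) (z : closedForms R V m i) :
    ∃ h, cohomologyRep R V m hm i g (closedClass hm z) =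
      closedClass hm ⟨ambientRep R V g z, h⟩ :=
  ⟨⟨ambientRep_mem g z.2.1, by
    change phi R V _ = 0
    rw [← ambientRep_phi g z.2.1, LinearMap.mem_ker.1 z.2.2, map_zero]⟩, rfl⟩

end classes

/-! ### The comparison map -/

section comparison

variable {ι : Type v} [LinearOrder ι] (b : Module.Basis ι R V)
variable {p m n : ℕ} (i : ℕ)

theorem homotopy_mem_piece {z : Ambient R V}
    (hz : z ∈ piece R V (i + 1) ((m : ℤ) - i - 1)) :
    homotopy b p z ∈ piece R V i ((m : ℤ) - i) := by
  simpa using homotopy_mem b p hz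

variable [Fact p.Prime] [CharP R p] (hm : (m : R) = 0) (hn : m = p * n)

include hn in
theorem cartier_mem_closedForms {y : Ambient R V}
    (hy : y ∈ piece R V (i + 1) ((n : ℤ) - i - 1)) : cartier b p y ∈ closedForms R V m i := by
  refine ⟨cartier_mem b p (Nat.Prime.pos Fact.out) ?_ hy, phi_cartier b p y⟩
  subst hn
  push_cast
  ring

/-- The inverse Cartier operator on the forms that represent `S_{(n-i,1ⁱ)}(V)`. -/
def cartierClosed :
    piece R V (i + 1) ((n : ℤ) - i - 1) →ₛₗ[frobenius R p] closedForms R V m i :=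
  ((cartier b p).comp (piece R V (i + 1) ((n : ℤ) - i - 1)).subtype).codRestrict _
    fun y => cartier_mem_closedForms b i hn y.2

/-- The semilinear map `S_{(n-i,1ⁱ)}(V) → Hⁱ(N_m(V))` induced by the inverse Cartier operator. -/
def cartierClass :
    HookSchur R V ((n : ℤ) - i) i →ₛₗ[frobenius R p] Cohomology R V m hm i :=
  (hookRel R V ((n : ℤ) - i) i).liftQ ((closedClass hm).comp (cartierClosed b i hn)) <| by
    rintro ⟨y, hy⟩ ⟨u, hu, e⟩
    refine LinearMap.mem_ker.2 ((closedClass_eq_zero hm).2 ?_)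
    refine termMk_mem_coboundaries hm _ (u := 0) (u' := cartier b p u) (zero_mem _) ?_ ?_
    · refine cartier_mem b p (Nat.Prime.pos Fact.out) ?_ hu
      subst hn
      push_cast
      ring
    · rw [map_zero, zero_add, ← cartier_kappa]
      exact congrArg (cartier b p) e.symm

/-- The linear map `FᵖS_{(n-i,1ⁱ)}(V) → Hⁱ(N_m(V))` induced by the inverse Cartier operator. -/
def comparison : FrobTwist R p (HookSchur R V ((n : ℤ) - i) i) →ₗ[R] Cohomology R V m hm i :=
  FrobTwist.lift (cartierClass b i hm hn)

theorem comparison_of_mk (y : piece R V (i + 1) ((n : ℤ) - i - 1)) :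
    comparison b i hm hn (FrobTwist.of p (Submodule.Quotient.mk y)) =
      closedClass hm (cartierClosed b i hn y) :=
  FrobTwist.lift_of _ _

/-- The retraction is applied to forms rather than to cohomology classes. Each `x` has a closed form
`z` that represents its image and retracts to `x`. If the class of `z` is zero, then `z = φ u + κ
u'`, and the retraction kills both summands. -/
theorem comparison_injective : Function.Injective (comparison b i hm hn : _ →ₗ[R] _) := by
  -- `cartierRetract` needs a map defined on all forms, so the quotient map is extended by the
  -- projection onto its bidegree.
  let Q : Ambient R V →ₗ[R] HookSchur R V ((n : ℤ) - i) i :=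
    (hookRel R V ((n : ℤ) - i) i).mkQ ∘ₗ pieceProj b _ _
  have hQ (y : piece R V (i + 1) ((n : ℤ) - i - 1)) : Q y = Submodule.Quotient.mk y := by
    simp only [Q, LinearMap.comp_apply, pieceProj_coe, Submodule.mkQ_apply]
  have hlift : ∀ x, ∃ z : closedForms R V m i,
      comparison b i hm hn x = closedClass hm z ∧ cartierRetract b p Q z = x := by
    let N : Submodule R (FrobTwist R p (HookSchur R V ((n : ℤ) - i) i)) :=
      { carrier := {x | ∃ z : closedForms R V m i,
          comparison b i hm hn x = closedClass hm z ∧ cartierRetract b p Q z = x}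
        zero_mem' := ⟨0, by simp, by simp⟩
        add_mem' := by
          rintro x y ⟨z, hz, hz'⟩ ⟨t, ht, ht'⟩
          exact ⟨z + t, by rw [map_add, map_add, hz, ht],
            by rw [Submodule.coe_add, map_add, hz', ht']⟩
        smul_mem' := by
          rintro r x ⟨z, hz, hz'⟩
          exact ⟨r • z, by rw [map_smul, map_smul, hz],
            by rw [Submodule.coe_smul, map_smul, hz']⟩ }
    have hN : N = ⊤ := FrobTwist.eq_top_of_of_mem p fun w => by
      obtain ⟨y, rfl⟩ := Submodule.Quotient.mk_surjective _ w
      refine ⟨cartierClosed b i hn y, comparison_of_mk b i hm hn y, ?_⟩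
      rw [← hQ]
      exact cartierRetract_cartier b p Q y
    exact fun x => hN.ge (Submodule.mem_top (x := x))
  refine (injective_iff_map_eq_zero _).2 fun x hx => ?_
  obtain ⟨z, hz, rfl⟩ := hlift x
  obtain ⟨u, u', hu', e⟩ := exists_of_termMk_mem_coboundaries hm
    ((closedClass_eq_zero hm).1 (hz.symm.trans hx))
  rw [e, map_add, cartierRetract_phi, zero_add]
  refine cartierRetract_kappa b p Q (j := (n : ℤ) - i - 2) ?_ ?_ hu'
  · subst hn
    push_cast
    ring
  · intro y hy
    have h1 : kappa R V y ∈ piece R V (i + 1) ((n : ℤ) - i - 1) := by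
      have := kappa_mem (i := i + 1) hy
      rwa [show (n : ℤ) - i - 2 + 1 = n - i - 1 by ring] at this
    exact (hQ ⟨_, h1⟩).trans ((Submodule.Quotient.mk_eq_zero _).2 ⟨y, hy, rfl⟩)

theorem exists_comparison_eq_closedClass_divProj {z : Ambient R V}
    (hz : z ∈ piece R V (i + 1) ((m : ℤ) - i - 1)) :
    ∃ h : divProj b p z ∈ closedForms R V m i, ∃ x,
      comparison b i hm hn x = closedClass hm ⟨divProj b p z, h⟩ := by
  have hp := Nat.Prime.pos (p := p) Fact.out
  -- Closed forms whose class lies in the range form a submodule, so the claim can be checked on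
  -- monomials.
  let N := ((LinearMap.range (comparison b i hm hn)).comap
      (closedClass hm)).map (closedForms R V m i).subtype
  suffices divProj b p z ∈ N by
    obtain ⟨⟨z', h⟩, ⟨x, hx⟩, rfl⟩ := this
    exact ⟨h, x, hx⟩
  refine monomialSpan_le b (N := N.comap (divProj b p)) ?_
    (piece_le_monomialSpan b _ _ hz)
  rintro t ⟨h1, h2⟩
  rw [Submodule.mem_comap, divProj, Module.Basis.constr_basis]
  split_ifs with ht
  · obtain ⟨t', rfl⟩ := exists_cartierIndex_eq p ht
    have h3 : t'.1.card = i + 1 := h1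
    rw [degree_cartierIndex, h3] at h2
    have h4 : (t'.2.degree : ℤ) = (n : ℤ) - i - 1 := by
      subst hn
      push_cast [Nat.cast_sub (show 1 ≤ p from hp)] at h2
      have h5 : (p : ℤ) * t'.2.degree = p * ((n : ℤ) - i - 1) := by linear_combination h2
      exact mul_left_cancel₀ (by exact_mod_cast hp.ne') h5
    have h5 : monomials b t' ∈ piece R V (i + 1) ((n : ℤ) - i - 1) :=
      monomials_mem_piece b h3 h4
    exact ⟨cartierClosed b i hn ⟨_, h5⟩, ⟨_, comparison_of_mk b i hm hn ⟨_, h5⟩⟩,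
      cartier_monomials b p t'⟩
  · exact zero_mem _

/-- A cocycle satisfies only `φ z = κ u`. The homotopy formula and `h κ = - κ h` give `z - π z = φ h
z - κ h u`, so the closed form `π z` represents the same class, and `π z` comes from `cartier`. -/
theorem comparison_surjective : Function.Surjective (comparison b i hm hn : _ →ₗ[R] _) := by
  intro c
  obtain ⟨⟨x, hx⟩, rfl⟩ := Submodule.Quotient.mk_surjective _ c
  obtain ⟨⟨z, hz⟩, rfl⟩ := Submodule.Quotient.mk_surjective _ x
  obtain ⟨h1, e⟩ := diff_termMk hm ⟨z, hz⟩
  obtain ⟨u, hu, hu'⟩ := termMk_eq_zero.1 (e.symm.trans hx)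
  obtain ⟨h2, x, hx'⟩ := exists_comparison_eq_closedClass_divProj b i hm hn hz
  refine ⟨x, hx'.trans (Eq.symm ?_)⟩
  refine (Submodule.Quotient.eq _).2 ?_
  have h3 := phi_homotopy_add b p z
  refine termMk_mem_coboundaries hm (sub_mem hz h2.1) (homotopy_mem_piece (p := p) b i hz)
    (u' := - homotopy b p u) ?_ ?_
  · refine neg_mem ?_
    have h4 := homotopy_mem b p (i := i + 2) hu
    rwa [show (m : ℤ) - (i + 1 : ℕ) - 2 + 1 = (m : ℤ) - i - 2 by push_cast; ring] at h4
  · rw [← h3, map_neg, ← homotopy_kappa, hu']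

theorem comparison_frobTwistRep (g : LinearMap.GeneralLinearGroup R V)
    (x : FrobTwist R p (HookSchur R V ((n : ℤ) - i) i)) :
    comparison b i hm hn (frobTwistRep p (hookRep R V ((n : ℤ) - i) i) g x) =
      cohomologyRep R V m hm i g (comparison b i hm hn x) := by
  suffices h : LinearMap.eqLocus
      (comparison b i hm hn ∘ₗ frobTwistRep p (hookRep R V ((n : ℤ) - i) i) g)
      (cohomologyRep R V m hm i g ∘ₗ comparison b i hm hn) = ⊤ from
    LinearMap.mem_eqLocus.1 (h.ge (Submodule.mem_top (x := x)))
  refine FrobTwist.eq_top_of_of_mem p fun w => ?_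
  obtain ⟨y, rfl⟩ := Submodule.Quotient.mk_surjective _ w
  rw [LinearMap.mem_eqLocus, LinearMap.comp_apply, LinearMap.comp_apply, frobTwistRep_of,
    comparison_of_mk]
  obtain ⟨h1, e1⟩ := closedClass_ambientRep hm g (cartierClosed b i hn y)
  have hgy : ambientRep R V g y ∈ piece R V (i + 1) ((n : ℤ) - i - 1) := ambientRep_mem g y.2
  refine (comparison_of_mk b i hm hn ⟨_, hgy⟩).trans ?_
  rw [e1, ← sub_eq_zero, ← map_sub, closedClass_eq_zero]
  obtain ⟨u, hu⟩ := cartier_ambientRep_sub_mem_range b p g (y : Ambient R V)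
  set r := cartierClosed b i hn ⟨_, hgy⟩ - ⟨ambientRep R V g (cartierClosed b i hn y), h1⟩
  have hr : phi R V u = r := hu
  -- The primitive `u` of `r` has no known bidegree. The homotopy supplies a homogeneous one: `φ r =
  -- 0` and `π r = π (φ u) = 0` give `r = φ (h r)`.
  refine termMk_mem_coboundaries hm r.2.1 (homotopy_mem_piece (p := p) b i r.2.1) (u' := 0)
    (zero_mem _) ?_
  have h3 := phi_homotopy_add b p (r : Ambient R V)
  rw [LinearMap.mem_ker.1 r.2.2, ← hr, divProj_phi, map_zero, sub_zero, add_zero, hr] at h3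
  rw [h3, map_zero, add_zero]

end comparison

end HookComplex

end

/-! ### The theorem for a free module, by choice of a basis -/

theorem mainTheorem1 {R : Type*} [CommRing R] (p : ℕ) [Fact p.Prime] [CharP R p]
    {V : Type*} [AddCommGroup V] [Module R V] [Module.Free R V]
    (m : ℕ) (hm : 0 < m) (hpm : p ∣ m) :
    (∀ i : ℕ,
      HookComplex.diff R V m ((CharP.cast_eq_zero_iff R p m).2 hpm) (i + 1) ∘ₗ
        HookComplex.diff R V m ((CharP.cast_eq_zero_iff R p m).2 hpm) i = 0) ∧
    ∀ i : ℕ, Nonempty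
      ((HookComplex.cohomologyRep R V m ((CharP.cast_eq_zero_iff R p m).2 hpm) i).Equiv
        (HookComplex.frobTwistRep p
          (HookComplex.hookRep R V (((m / p : ℕ) : ℤ) - i) i))) := by
  classical
  obtain ⟨⟨ι, b⟩⟩ := Module.Free.exists_basis (R := R) (M := V)
  -- An order on the index set is needed to write down the exterior monomials; any one will do.
  let : LinearOrder ι := linearOrderOfSTO WellOrderingRel
  have hm0 : (m : R) = 0 := (CharP.cast_eq_zero_iff R p m).2 hpm
  refine ⟨fun i => LinearMap.ext fun x => ?_, fun i => ⟨Representation.Equiv.symm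
    (.mk (LinearEquiv.ofBijective
      (HookComplex.comparison b i hm0 (Nat.mul_div_cancel' hpm).symm)
      ⟨HookComplex.comparison_injective b i hm0 _, HookComplex.comparison_surjective b i hm0 _⟩)
      fun g => LinearMap.ext fun x => HookComplex.comparison_frobTwistRep b i hm0 _ g x)⟩⟩
  obtain ⟨y, rfl⟩ := Submodule.Quotient.mk_surjective _ x
  obtain ⟨h1, e1⟩ := HookComplex.diff_termMk hm0 y
  obtain ⟨h2, e2⟩ := HookComplex.diff_termMk hm0 ⟨_, h1⟩
  refine (congrArg _ e1).trans (e2.trans ?_)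
  refine (congrArg _ (Subtype.ext ?_)).trans (map_zero _)
  exact HookComplex.phi_phi b (y : HookComplex.Ambient R V)
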